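/- Let $(A,\nu,T)$ be an ergodic measure-preserving dynamical system on a probability space, let $M$ be a $\mathcal{C}^1$ manifold (Hausdorff, second countable) of dimension $n\ge 1$, and let $v\in\mathcal{C}^1(M,\mathbb{R}_+^*)$. Let $$\widetilde A:=(A\times[0,1])/\big((x,1)\sim(T(x),0)\big)$$ be the suspension of $T$ with constant roof $1$, endowed with the measure $\tilde\nu:=\nu\otimes\mathrm{Leb}$ on the fundamental domain $A\times[0,1)$, and for $c\ge 0$ put $g^c_t[(x,s)]:=[(x,s+ct)]$ for $t\ge 0$, that is, $g^c_t[(x,s)]=[(T^{k}x,\,s+ct-k)]$ with $k=\lfloor s+ct\rfloor$. Put $\Omega:=\widetilde A\times M$ and $$g_t(x,y):=\big(g_t^{v(y)}(x),\,y\big),\qquad t\ge 0 .$$ Let $\mu=\tilde\nu\otimes\tilde\mu$, where $\tilde\mu$ is a Borel probability measure on $M$ which is absolutely continuous with respect to the Lebesgue measure class $\mathrm{Leb}$ of $M$ (a subset of $M$ is $\mathrm{Leb}$-null if its image in every $\mathcal{C}^1$ chart is Lebesgue-null). If $\mathrm{Leb}(\{y\in M: dv(y)=0\})=0$, then $(\Omega,\mu,(g_t)_{t\ge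 0})$ exhibits Keplerian shear: $(g_t)_{t\ge0}$ is a semi-flow which preserves the probability measure $\mu$ and, for every $f\in\mathbb{L}^2(\Omega,\mu)$ (complex-valued), $$\lim_{t\to+\infty} f\circ g_t=\mathbb{E}_\mu(f\mid\mathcal{I})\quad\text{weakly in }\mathbb{L}^2(\Omega,\mu),$$ where $\mathcal{I}$ is the $\sigma$-algebra of the measurable sets $B$ such that $g_t^{-1}(B)=B$ for all times $t$. The same holds when $T$ is invertible (with measurable inverse), $v\in\mathcal{C}^1(M,\mathbb{R})$ may take any real values, and $(g_t)_{t\in\mathbb{R}}$ is the flow given by the same formulas with $c,t\in\mathbb{R}$, again under the assumption $\mathrm{Leb}(\{dv=0\})=0$. -/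

import Mathlib

open MeasureTheory Set Filter Topology
open scoped NNReal Manifold ComplexConjugate

namespace KeplerianShear

/-! ### Keplerian shear -/

section Shear

variable {ι Ω : Type*} [MeasurableSpace Ω]

/-- The family `(g t)` is a (semi-)flow preserving the probability measure `μ`.
The time set `ι` is `ℝ≥0` for a semi-flow and `ℝ` for a flow. -/
structure IsMeasurePreservingSystem [AddMonoid ι] (g : ι → Ω → Ω) (μ : Measure Ω) : Prop where
  isProbabilityMeasure : IsProbabilityMeasure μ
  zero : g 0 = id
  add : ∀ s t, g (s + t) = g s ∘ g t
  measurePreserving : ∀ t, MeasurePreserving (g t) μ μ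

/-- The invariant `σ`-algebra: measurable sets `B` with `g t ⁻¹' B = B` for all times `t`. -/
@[reducible]
def invariantSigmaAlgebra (g : ι → Ω → Ω) : MeasurableSpace Ω :=
  ⨅ t, MeasurableSpace.invariants (g t)

/-- Keplerian shear: `g` is a (semi-)flow preserving the probability measure `μ` and, for every
complex-valued `f ∈ L²(Ω, μ)`, the functions `f ∘ g t` converge to `E_μ (f | I)` for the weak
topology of `L²(Ω, μ)` as `t → + ∞`, that is, when tested against every `h ∈ L²(Ω, μ)`. -/
def ExhibitsKeplerianShear [AddMonoid ι] [Preorder ι] (g : ι → Ω → Ω) (μ : Measure Ω) : Prop :=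
  IsMeasurePreservingSystem g μ ∧
    ∀ f h : Ω → ℂ, MemLp f 2 μ → MemLp h 2 μ →
      Tendsto (fun t : ι => ∫ ω, conj (h ω) * f (g t ω) ∂μ) atTop
        (𝓝 (∫ ω, conj (h ω) * (μ[f | invariantSigmaAlgebra g]) ω ∂μ))

end Shear

/-! ### Suspensions with constant roof `1` -/

section Suspension

variable {A : Type*}

/-- The gluing relation `(x, 1) ∼ (T x, 0)` on `A × [0, 1]`. -/
def SuspensionRel (T : A → A) (p q : A × unitInterval) : Prop :=
  p.2 = 1 ∧ q = (T p.1, 0)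

/-- The suspension space `(A × [0, 1]) / ((x, 1) ∼ (T x, 0))`: the quotient by the equivalence
relation generated by the gluing relation. -/
def Suspension (T : A → A) : Type _ := Quot (SuspensionRel T)

/-- The class `[(x, s)]`. -/
def Suspension.mk (T : A → A) (p : A × unitInterval) : Suspension T := Quot.mk _ p

/-- The quotient `σ`-algebra. -/
instance [MeasurableSpace A] (T : A → A) : MeasurableSpace (Suspension T) :=
  MeasurableSpace.map (Suspension.mk T) inferInstance

/-- The measure `ν ⊗ Leb` on the suspension space. (The slice `s = 1` is `ν ⊗ Leb`-negligible, so
this is the same as `ν ⊗ Leb` on the fundamental domain `A × [0, 1)`.) -/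
noncomputable def suspensionMeasure [MeasurableSpace A] (T : A → A) (ν : Measure A) :
    Measure (Suspension T) :=
  (ν.prod (volume : Measure unitInterval)).map (Suspension.mk T)

/-- The fractional part, as a point of `[0, 1]`. -/
noncomputable def fractI (r : ℝ) : unitInterval :=
  ⟨Int.fract r, Int.fract_nonneg r, (Int.fract_lt_one r).le⟩

/-- The unit speed suspension semi-flow at time `c ≥ 0`: `[(x, s)] ↦ [(x, s + c)]`, which after
reduction to the fundamental domain is `[(T^k x, s + c - k)]` with `k = ⌊s + c⌋`. -/
noncomputable def suspensionSemiflow (T : A → A) (c : ℝ≥0) : Suspension T → Suspension T :=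
  Quot.lift
    (fun p => Suspension.mk T (T^[⌊(p.2 : ℝ) + (c : ℝ)⌋₊] p.1, fractI ((p.2 : ℝ) + (c : ℝ))))
    (by
      rintro ⟨x, s⟩ ⟨y, r⟩ ⟨h1, h2⟩
      simp only [Prod.mk.injEq] at h1 h2
      obtain ⟨rfl, rfl⟩ := h2
      subst h1
      have hf : ⌊(1 : ℝ) + (c : ℝ)⌋₊ = ⌊(c : ℝ)⌋₊ + 1 := by
        rw [add_comm]
        exact Nat.floor_add_one c.2
      have hr : fractI ((1 : ℝ) + (c : ℝ)) = fractI (c : ℝ) :=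
        Subtype.ext (by simp [fractI])
      simp only [Set.Icc.coe_one, Set.Icc.coe_zero, zero_add, hf, hr,
        Function.iterate_succ_apply])

/-- For invertible `T`, the unit speed suspension flow at time `c ∈ ℝ`. -/
noncomputable def suspensionFlow [MeasurableSpace A] (T : A ≃ᵐ A) (c : ℝ) :
    Suspension T → Suspension T :=
  Quot.lift
    (fun p => Suspension.mk T
      (((T.toEquiv : Equiv.Perm A) ^ ⌊(p.2 : ℝ) + c⌋) p.1, fractI ((p.2 : ℝ) + c)))
    (by
      rintro ⟨x, s⟩ ⟨y, r⟩ ⟨h1, h2⟩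
      simp only [Prod.mk.injEq] at h1 h2
      obtain ⟨rfl, rfl⟩ := h2
      subst h1
      have hf : ⌊(1 : ℝ) + c⌋ = ⌊c⌋ + 1 := by
        rw [add_comm, Int.floor_add_one]
      have hr : fractI ((1 : ℝ) + c) = fractI c :=
        Subtype.ext (by simp [fractI])
      simp only [Set.Icc.coe_one, Set.Icc.coe_zero, zero_add, hf, hr, zpow_add_one]
      rfl)

variable {M : Type*}

/-- The semi-flow `g_t (x, y) = (g_t^{v(y)} x, y)` on the product of the suspension space and `M`,
where `g_t^v [(x, s)] = [(x, s + v t)]`. -/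
noncomputable def fiberedSemiflow (T : A → A) (v : M → ℝ≥0) (t : ℝ≥0) :
    Suspension T × M → Suspension T × M :=
  fun p => (suspensionSemiflow T (v p.2 * t) p.1, p.2)

/-- The flow `g_t (x, y) = (g_t^{v(y)} x, y)`, for invertible `T` and real-valued `v`. -/
noncomputable def fiberedFlow [MeasurableSpace A] (T : A ≃ᵐ A) (v : M → ℝ) (t : ℝ) :
    Suspension T × M → Suspension T × M :=
  fun p => (suspensionFlow T (v p.2 * t) p.1, p.2)

end Suspension

/-! ### Lebesgue null sets of a `C¹` manifold -/

section Manifold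

variable (n : ℕ) {M : Type*} [TopologicalSpace M] [ChartedSpace (EuclideanSpace ℝ (Fin n)) M]

/-- `Leb(N) = 0` on a `C¹` manifold: the image of `N` in every `C¹` chart is Lebesgue-null. -/
def LebesgueNull (N : Set M) : Prop :=
  ∀ φ ∈ IsManifold.maximalAtlas (𝓡 n) 1 M, volume (φ '' (N ∩ φ.source)) = 0

/-- `μ ≪ Leb` on a `C¹` manifold. -/
def LebesgueAbsolutelyContinuous [MeasurableSpace M] (μ : Measure M) : Prop :=
  ∀ N : Set M, MeasurableSet N → LebesgueNull n N → μ N = 0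

end Manifold

end KeplerianShear

namespace KeplerianShear

/-! ### Weak convergence in `L²` -/

section WeakConvergence

variable {Ω ι : Type*} {m mΩ : MeasurableSpace Ω} {μ : Measure Ω} [IsFiniteMeasure μ]

/-! In coordinates `(y, s, x)` on `M × [0, 1) × A`, the system translates the fibre above `y` by `v
y * t`. For two boxes, the correlation at time `t` is the integral of `D (s + v y * t)` over `s ∈
S₂` and `y ∈ M₁ ∩ M₂`, where `D w` is `1_{S₁} (fract w)` times the correlation of the base at time
`⌊w⌋` (`measureReal_box_inter_preimage_box`). Two facts give its limit.

Ergodicity gives `D` the Cesàro mean `ν(A₂) ν(A₁) Leb(S₁)`, by von Neumann's theorem. Since the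
critical points of `v` are negligible, the law of `v` is absolutely continuous
(`map_absolutelyContinuous_volume`). A bounded function with a mean, sped up indefinitely, converges
weakly-* to that mean (`tendsto_integral_comp_mul_zero`). Averaging over speeds thus replaces
averaging over time, and no mixing of `T` is needed.

The limit is the integral over one box of the conditional expectation of the indicator of the other
given the coordinate `y`. Density extends this to all of `L²`
(`tendsto_integral_conj_mul_comp_of_indicator`). The invariant `σ`-algebra is never computed: it
contains the one generated by `y`, and the weak convergence itself forces the two conditional
expectations to agree (`condExp_invariantSigmaAlgebra_ae_eq`). -/

theorem isClosed_setOf_tendsto_of_norm_le {E F : Type*} [NormedAddCommGroup E] [NormedSpace ℝ E]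
    [NormedAddCommGroup F] [NormedSpace ℝ F] {l : Filter ι} (L : ι → E →L[ℝ] F) (L₀ : E →L[ℝ] F)
    (K : ℝ≥0) (hL : ∀ t, ‖L t‖ ≤ K) :
    IsClosed {f : E | Tendsto (fun t => L t f) l (𝓝 (L₀ f))} :=
  (LipschitzWith.uniformEquicontinuous (fun t f => L t f) K
    fun t => (L t).lipschitz.weaken (hL t)).equicontinuous.isClosed_setOfPred_tendsto
      L₀.continuous

/-- A closed subspace of `L²` which contains the indicators of the members of a `π`-system
generating the `σ`-algebra is everything. -/
theorem eq_top_of_indicatorConstLp_mem {C : Set (Set Ω)} (hC : mΩ = .generateFrom C)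
    (hpi : IsPiSystem C) (huniv : univ ∈ C) (V : Submodule ℂ (Lp ℂ 2 μ))
    (hV : IsClosed (V : Set (Lp ℂ 2 μ)))
    (hind : ∀ s (hs : MeasurableSet s), s ∈ C →
      indicatorConstLp 2 hs (measure_ne_top μ s) (1 : ℂ) ∈ V) : V = ⊤ := by
  have : CompleteSpace V := hV.completeSpace_coe
  -- A vector orthogonal to `V` has zero integral over members of `C`, hence over all measurable
  -- sets by Dynkin's lemma, so it vanishes.
  rw [← Submodule.orthogonal_eq_bot_iff, eq_bot_iff]
  intro u hu
  have hint : Integrable u μ := (Lp.memLp u).integrable one_le_two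
  have key : ∀ s (hs : MeasurableSet s), ∫ x in s, u x ∂μ = 0 := by
    have hb : ∀ s (hs : MeasurableSet s), s ∈ C → ∫ x in s, u x ∂μ = 0 := by
      intro s hs hsC
      rw [← L2.inner_indicatorConstLp_one hs (measure_ne_top μ s)]
      exact (Submodule.mem_orthogonal _ _).1 hu _ (hind s hs hsC)
    refine MeasurableSpace.induction_on_inter hC hpi (by simp)
      (fun t ht => hb t (hC ▸ .basic t ht) ht) ?_ ?_
    · intro t ht h0
      have h1 := hb univ .univ huniv
      rw [setIntegral_univ, ← integral_add_compl ht hint, h0, zero_add] at h1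
      exact h1
    · intro f hd hf h0
      rw [integral_iUnion hf hd hint.integrableOn]
      simp [h0]
  rw [Submodule.mem_bot]
  refine (Lp.eq_zero_iff_ae_eq_zero).2 ?_
  exact hint.ae_eq_zero_of_forall_setIntegral_eq_zero fun s hs _ => key s hs

/-- Density is used once per variable: first in `h` with `f` an indicator, then in `f` with `h`
arbitrary. The uniform bound on `W t` keeps both sets of good vectors closed. -/
theorem tendsto_inner_of_indicator {C : Set (Set Ω)} (hC : mΩ = .generateFrom C)
    (hpi : IsPiSystem C) (huniv : univ ∈ C) {l : Filter ι} (W : ι → Lp ℂ 2 μ →L[ℂ] Lp ℂ 2 μ)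
    (K : ℝ≥0) (hW : ∀ t, ‖W t‖ ≤ K)
    (hind : ∀ r s (hr : MeasurableSet r) (hs : MeasurableSet s), r ∈ C → s ∈ C →
      Tendsto (fun t => inner ℂ (indicatorConstLp 2 hr (measure_ne_top μ r) (1 : ℂ))
        (W t (indicatorConstLp 2 hs (measure_ne_top μ s) (1 : ℂ)))) l (𝓝 0))
    (h f : Lp ℂ 2 μ) : Tendsto (fun t => inner ℂ h (W t f)) l (𝓝 0) := by
  -- The inner product is swapped so that it is linear, not conjugate-linear, in `h`.
  have step : ∀ s (hs : MeasurableSet s), s ∈ C → ∀ h : Lp ℂ 2 μ,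
      Tendsto (fun t => inner ℂ (W t (indicatorConstLp 2 hs (measure_ne_top μ s) (1 : ℂ))) h)
        l (𝓝 0) := by
    intro s hs hsC h
    set u : Lp ℂ 2 μ := indicatorConstLp 2 hs (measure_ne_top μ s) (1 : ℂ) with hu
    let V : Submodule ℂ (Lp ℂ 2 μ) :=
      { carrier := {h | Tendsto (fun t => inner ℂ (W t u) h) l (𝓝 0)}
        add_mem' := fun {a b} ha hb => by
          simpa [inner_add_right] using Tendsto.add ha hb
        zero_mem' := by simpa using tendsto_const_nhds
        smul_mem' := fun c a ha => by
          simpa [inner_smul_right] using Tendsto.const_mul c ha }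
    have hVtop : V = ⊤ := by
      refine eq_top_of_indicatorConstLp_mem hC hpi huniv V ?_ ?_
      · refine isClosed_setOf_tendsto_of_norm_le
          (fun t => ((innerSL ℂ (W t u)).restrictScalars ℝ)) 0 (K * ‖u‖₊) fun t => ?_
        simpa using (W t).le_of_opNorm_le (hW t) u
      · intro r hr hrC
        have := (hind r s hr hs hrC hsC).star
        simp only [star_zero] at this
        refine this.congr fun t => ?_
        exact inner_conj_symm _ _
    have : h ∈ V := hVtop ▸ Submodule.mem_top
    exact this
  let V : Submodule ℂ (Lp ℂ 2 μ) :=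
    { carrier := {f | Tendsto (fun t => inner ℂ h (W t f)) l (𝓝 0)}
      add_mem' := fun {a b} ha hb => by
        simpa [inner_add_right] using Tendsto.add ha hb
      zero_mem' := by simpa using tendsto_const_nhds
      smul_mem' := fun c a ha => by
        simpa [inner_smul_right] using Tendsto.const_mul c ha }
  have hVtop : V = ⊤ := by
    refine eq_top_of_indicatorConstLp_mem hC hpi huniv V ?_ ?_
    · refine isClosed_setOf_tendsto_of_norm_le
        (fun t => (((innerSL ℂ h).comp (W t)).restrictScalars ℝ)) 0 (‖h‖₊ * K) fun t => ?_
      rw [ContinuousLinearMap.norm_restrictScalars]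
      refine ((innerSL ℂ h).opNorm_comp_le (W t)).trans ?_
      simpa using mul_le_mul_of_nonneg_left (hW t) (norm_nonneg h)
    · intro s hs hsC
      have := (step s hs hsC h).star
      simp only [star_zero] at this
      refine this.congr fun t => ?_
      exact inner_conj_symm _ _
  have : f ∈ V := hVtop ▸ Submodule.mem_top
  exact this

theorem exists_clm_ae_eq_condExp (hm : m ≤ mΩ) : ∃ P : Lp ℂ 2 μ →L[ℂ] Lp ℂ 2 μ, ‖P‖ ≤ 1 ∧
    ∀ {u : Ω → ℂ} (hu : MemLp u 2 μ), P hu.toLp =ᵐ[μ] μ[u | m] :=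
  ⟨(lpMeas ℂ ℂ m 2 μ).subtypeL.comp (condExpL2 ℂ ℂ hm),
    ContinuousLinearMap.opNorm_le_bound _ zero_le_one fun u => by
      simpa only [one_mul] using! norm_condExpL2_coe_le (𝕜 := ℂ) hm u,
    fun hu => hu.condExpL2_ae_eq_condExp (𝕜 := ℂ) hm⟩

theorem exists_clm_comp_measurePreserving {g : Ω → Ω} (hg : MeasurePreserving g μ μ) :
    ∃ U : Lp ℂ 2 μ →L[ℂ] Lp ℂ 2 μ, ‖U‖ ≤ 1 ∧
      (∀ {f : Ω → ℂ} (hf : MemLp f 2 μ), U hf.toLp = (hf.comp_measurePreserving hg).toLp) ∧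
      ∀ {s} (hs : MeasurableSet s), U (indicatorConstLp 2 hs (measure_ne_top μ s) (1 : ℂ)) =
        indicatorConstLp 2 (hg.measurable hs) (measure_ne_top μ _) (1 : ℂ) := by
  refine ⟨(Lp.compMeasurePreservingₗᵢ ℂ g hg).toContinuousLinearMap, ?_, ?_, ?_⟩
  · exact LinearIsometry.norm_toContinuousLinearMap_le _
  · intro f hf
    exact Lp.toLp_compMeasurePreserving hf hg
  · intro s hs
    exact Lp.indicatorConstLp_compMeasurePreserving hs (measure_ne_top μ s) (1 : ℂ) hg

/-- Weak convergence of `f ∘ g t` to a conditional expectation may be tested on the indicators of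
the members of a generating `π`-system. -/
theorem tendsto_integral_conj_mul_comp_of_indicator {C : Set (Set Ω)} (hC : mΩ = .generateFrom C)
    (hpi : IsPiSystem C) (huniv : univ ∈ C) {l : Filter ι} {g : ι → Ω → Ω}
    (hg : ∀ t, MeasurePreserving (g t) μ μ) (hm : m ≤ mΩ)
    (hind : ∀ r s, MeasurableSet r → MeasurableSet s → r ∈ C → s ∈ C →
      Tendsto (fun t => ((μ.real (r ∩ g t ⁻¹' s) : ℝ) : ℂ)) l
        (𝓝 (∫ ω in r, (μ[s.indicator fun _ => (1 : ℂ) | m]) ω ∂μ)))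
    {f h : Ω → ℂ} (hf : MemLp f 2 μ) (hh : MemLp h 2 μ) :
    Tendsto (fun t => ∫ ω, conj (h ω) * f (g t ω) ∂μ) l
      (𝓝 (∫ ω, conj (h ω) * (μ[f | m]) ω ∂μ)) := by
  obtain ⟨P, hP, hPae⟩ := exists_clm_ae_eq_condExp (μ := μ) hm
  choose U hU hUf hUs using fun t => exists_clm_comp_measurePreserving (hg t)
  have key := tendsto_inner_of_indicator hC hpi huniv (l := l) (fun t => U t - P) 2
    (fun t => (norm_sub_le _ _).trans ((add_le_add (hU t) hP).trans_eq one_add_one_eq_two)) ?_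
    hh.toLp hf.toLp
  · have h2 := key.add_const (inner ℂ hh.toLp (P hf.toLp))
    rw [zero_add] at h2
    have e1 : inner ℂ hh.toLp (P hf.toLp) = ∫ ω, conj (h ω) * (μ[f | m]) ω ∂μ := by
      rw [L2.inner_def]
      refine integral_congr_ae ?_
      filter_upwards [hPae hf, hh.coeFn_toLp] with ω h1 h2
      rw [h1, h2, RCLike.inner_apply, mul_comm]
    rw [e1] at h2
    refine h2.congr fun t => ?_
    rw [← e1, sub_apply, inner_sub_right, sub_add_cancel, L2.inner_def]
    refine integral_congr_ae ?_
    rw [hUf t hf]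
    filter_upwards [(hf.comp_measurePreserving (hg t)).coeFn_toLp, hh.coeFn_toLp] with ω h1 h2
    rw [h1, h2, RCLike.inner_apply, mul_comm, Function.comp_apply]
  · intro r s hr hs hrC hsC
    have h1 := (hind r s hr hs hrC hsC).sub_const
      (∫ ω in r, (μ[s.indicator fun _ => (1 : ℂ) | m]) ω ∂μ)
    rw [sub_self] at h1
    refine h1.congr fun t => ?_
    rw [sub_apply, inner_sub_right]
    congr 1
    · rw [hUs, L2.inner_indicatorConstLp_indicatorConstLp]
      simp
    · rw [L2.inner_indicatorConstLp_one]
      refine setIntegral_congr_ae hr ?_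
      filter_upwards [hPae (memLp_indicator_const 2 hs (1 : ℂ) (Or.inr (measure_ne_top μ s)))]
        with ω h1 _
      exact h1.symm

/-- If every `m`-measurable set is invariant and `f ∘ g t` converges weakly to `μ[f | m]` for all
`f`, then `m` may be replaced by the invariant `σ`-algebra. -/
theorem condExp_invariantSigmaAlgebra_ae_eq {l : Filter ι} [l.NeBot] {g : ι → Ω → Ω}
    (hg : ∀ t, MeasurePreserving (g t) μ μ)
    (hm : m ≤ invariantSigmaAlgebra g) (hI : invariantSigmaAlgebra g ≤ mΩ)
    {f : Ω → ℂ} (hf : MemLp f 2 μ)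
    (H : ∀ h : Ω → ℂ, MemLp h 2 μ → Tendsto (fun t => ∫ ω, conj (h ω) * f (g t ω) ∂μ) l
      (𝓝 (∫ ω, conj (h ω) * (μ[f | m]) ω ∂μ))) :
    μ[f | m] =ᵐ[μ] μ[f | invariantSigmaAlgebra g] := by
  refine ae_eq_condExp_of_forall_setIntegral_eq hI (hf.integrable one_le_two)
    (fun _ _ _ => integrable_condExp.integrableOn) (fun B hB _ => ?_)
    (stronglyMeasurable_condExp.mono hm).aestronglyMeasurable
  have hBm : MeasurableSet B := hI B hB
  have hBt : ∀ t, g t ⁻¹' B = B := fun t =>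
    (MeasurableSpace.measurableSet_invariants.1
      (iInf_le (fun t => MeasurableSpace.invariants (g t)) t B hB)).2
  have lim := H (B.indicator fun _ => 1)
    (memLp_indicator_const 2 hBm (1 : ℂ) (Or.inr (measure_ne_top μ B)))
  have e : ∀ F : Ω → ℂ, ∫ ω, conj (B.indicator (fun _ => (1 : ℂ)) ω) * F ω ∂μ
      = ∫ ω in B, F ω ∂μ := by
    intro F
    rw [← integral_indicator hBm]
    congr 1 with ω
    by_cases hω : ω ∈ B <;> simp [hω]
  rw [e] at lim
  -- For invariant `B`, the integral of `f ∘ g t` over `B` does not depend on `t`; its limit is the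
  -- integral of `μ[f | m]` over `B`.
  refine tendsto_nhds_unique lim (tendsto_const_nhds.congr fun t => ?_)
  rw [e]
  have h1 := integral_map (hg t).aemeasurable (f := B.indicator f)
    ((hg t).map_eq.symm ▸ hf.1.indicator hBm)
  rw [(hg t).map_eq] at h1
  rw [← integral_indicator hBm, ← integral_indicator hBm, h1]
  congr 1 with ω
  have : g t ω ∈ B ↔ ω ∈ B := by
    conv_rhs => rw [← hBt t]
    rfl
  by_cases hω : ω ∈ B <;> simp [hω, this]

end WeakConvergence

/-! ### Absolute continuity of the law of a submersion -/

section Submersion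

/-- A `C¹` function of one real variable pulls null sets back to null sets, away from its critical
points. -/
theorem volume_setOf_deriv_ne_zero_inter_preimage {g : ℝ → ℝ} {N : Set ℝ} (hN : volume N = 0) :
    volume {r | ContDiffAt ℝ 1 g r ∧ deriv g r ≠ 0 ∧ g r ∈ N} = 0 := by
  refine measure_null_of_locally_null _ fun r hr => ?_
  obtain ⟨hg, hd, -⟩ := hr
  have hd' : HasDerivAt g (deriv g r) r := (hg.differentiableAt one_ne_zero).hasDerivAt
  have hF := hd'.hasFDerivAt_equiv hd
  -- Near `r`, the set lies in the image of `N` under the `C¹` local inverse, and differentiable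
  -- maps send null sets to null sets.
  set h := hg.localInverse hF one_ne_zero with hh
  have hcd : ContDiffAt ℝ 1 h (g r) := hg.to_localInverse hF one_ne_zero
  have hleft : ∀ᶠ x in 𝓝 r, h (g x) = x :=
    (hg.hasStrictFDerivAt' hF one_ne_zero).eventually_left_inverse
  have hdiff : ∀ᶠ z in 𝓝 (g r), DifferentiableAt ℝ h z :=
    (hcd.eventually (by simp)).mono fun z hz => hz.differentiableAt one_ne_zero
  have hev := hleft.and (hg.continuousAt.eventually hdiff)
  refine ⟨{x | h (g x) = x ∧ DifferentiableAt ℝ h (g x)} ∩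
    {r | ContDiffAt ℝ 1 g r ∧ deriv g r ≠ 0 ∧ g r ∈ N},
    inter_mem (mem_nhdsWithin_of_mem_nhds hev) self_mem_nhdsWithin, ?_⟩
  refine measure_mono_null (t := h '' (N ∩ {z | DifferentiableAt ℝ h z})) ?_ ?_
  · rintro x ⟨⟨h1, h2⟩, -, -, h3⟩
    exact ⟨g x, ⟨h3, h2⟩, h1⟩
  · exact addHaar_image_eq_zero_of_differentiableOn_of_addHaar_eq_zero volume
      (fun z hz => hz.2.differentiableWithinAt) (measure_mono_null inter_subset_left hN)

variable {n : ℕ}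

/-- A `C¹` function on an open subset of `ℝⁿ` pulls null sets back to null sets, away from its
critical points. -/
theorem volume_setOf_fderiv_ne_zero_inter_preimage {w : EuclideanSpace ℝ (Fin n) → ℝ}
    {O : Set (EuclideanSpace ℝ (Fin n))} (hO : IsOpen O) (hw : ContDiffOn ℝ 1 w O) {N : Set ℝ}
    (hNm : MeasurableSet N) (hN : volume N = 0) :
    volume {z ∈ O | fderiv ℝ w z ≠ 0 ∧ w z ∈ N} = 0 := by
  have hOw : MeasurableSet (O ∩ w ⁻¹' N) := by
    have h1 : MeasurableSet (O.domRestrict w ⁻¹' N) :=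
      hw.continuousOn.domRestrict.measurable hNm
    have h2 := hO.measurableSet.subtype_image h1
    convert! h2 using 1
    ext z
    simp [and_comm]
  have key : ∀ e : EuclideanSpace ℝ (Fin n),
      volume {z ∈ O | fderiv ℝ w z e ≠ 0 ∧ w z ∈ N} = 0 := by
    intro e
    have hm : MeasurableSet {z ∈ O | fderiv ℝ w z e ≠ 0 ∧ w z ∈ N} := by
      have h1 : MeasurableSet {z | fderiv ℝ w z e ≠ 0} :=
        (measurable_fderiv_apply_const ℝ w e) (measurableSet_singleton 0).compl
      convert! hOw.inter h1 using 1
      ext z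
      simp only [mem_ofPred_eq, mem_inter_iff, mem_preimage]
      tauto
    -- Fubini along the lines of direction `e`: on each line the one-variable lemma applies.
    have := ae_mem_of_ae_add_linearMap_mem (LinearMap.toSpanSingleton ℝ _ e) volume
      (volume : Measure (EuclideanSpace ℝ (Fin n))) hm.compl (fun y => ?_)
    · simpa [ae_iff] using this
    · rw [ae_iff]
      refine measure_mono_null ?_
        (volume_setOf_deriv_ne_zero_inter_preimage (g := fun r => w (y + r • e)) hN)
      intro r hr
      simp only [mem_compl_iff, not_not, LinearMap.toSpanSingleton_apply, mem_ofPred_eq] at hr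
      obtain ⟨h1, h2, h3⟩ := hr
      have hcd : ContDiffAt ℝ 1 w (y + r • e) := hw.contDiffAt (hO.mem_nhds h1)
      have hline : HasDerivAt (fun r : ℝ => y + r • e) e r := by
        simpa using ((hasDerivAt_id r).smul_const e).const_add y
      refine ⟨hcd.comp r (by fun_prop), ?_, h3⟩
      have := (hcd.differentiableAt one_ne_zero).hasFDerivAt.comp_hasDerivAt r hline
      rwa [show (fun r : ℝ => w (y + r • e)) = w ∘ fun r : ℝ => y + r • e from rfl, this.deriv]
  refine measure_mono_null (t := ⋃ i, {z ∈ O | fderiv ℝ w z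
    (EuclideanSpace.basisFun (Fin n) ℝ i) ≠ 0 ∧ w z ∈ N}) ?_ (measure_iUnion_null fun i => key _)
  rintro z ⟨h1, h2, h3⟩
  by_contra hcon
  simp only [mem_iUnion, mem_ofPred_eq, not_exists, not_and] at hcon
  refine h2 (ContinuousLinearMap.coe_injective
    ((EuclideanSpace.basisFun (Fin n) ℝ).toBasis.ext fun i => ?_))
  by_contra hi
  exact hcon i h1 (by simpa using hi) h3

variable {M : Type*} [TopologicalSpace M] [ChartedSpace (EuclideanSpace ℝ (Fin n)) M]
  [MeasurableSpace M] [BorelSpace M]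

/-- If the critical points of `v` are negligible, the law of `v` under an absolutely continuous
measure is absolutely continuous. -/
theorem map_absolutelyContinuous_volume {μM : Measure M}
    (hμM : LebesgueAbsolutelyContinuous n μM) {v : M → ℝ} (hv : ContMDiff (𝓡 n) 𝓘(ℝ, ℝ) 1 v)
    (hcrit : LebesgueNull n {y : M | mfderiv (𝓡 n) 𝓘(ℝ, ℝ) v y = 0}) :
    μM.map v ≪ volume := by
  refine Measure.AbsolutelyContinuous.mk fun N hNm hN => ?_
  rw [Measure.map_apply hv.continuous.measurable hNm]
  refine hμM _ (hv.continuous.measurable hNm) fun φ hφ => ?_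
  have hsymm : ContMDiffOn (𝓡 n) (𝓡 n) 1 φ.symm φ.target :=
    contMDiffOn_symm_of_mem_maximalAtlas hφ
  have hw : ContDiffOn ℝ 1 (v ∘ φ.symm) φ.target :=
    contMDiffOn_iff_contDiffOn.1 (hv.comp_contMDiffOn hsymm)
  refine measure_mono_null ?_ (measure_union_null (hcrit φ hφ)
    (volume_setOf_fderiv_ne_zero_inter_preimage φ.open_target hw hNm hN))
  rintro _ ⟨y, ⟨hyN, hy⟩, rfl⟩
  -- If the derivative in the chart vanishes, the chain rule makes `y` a critical point of `v`;
  -- otherwise the Euclidean lemma covers `φ y`.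
  by_cases h0 : fderiv ℝ (v ∘ φ.symm) (φ y) = 0
  · refine Or.inl ⟨y, ⟨?_, hy⟩, rfl⟩
    have hev : v =ᶠ[𝓝 y] (v ∘ φ.symm) ∘ φ := by
      filter_upwards [φ.open_source.mem_nhds hy] with x hx
      simp [φ.left_inv hx]
    have hφd : MDifferentiableAt (𝓡 n) (𝓡 n) φ y :=
      ((contMDiffOn_of_mem_maximalAtlas hφ).contMDiffAt
        (φ.open_source.mem_nhds hy)).mdifferentiableAt one_ne_zero
    have hwd : MDifferentiableAt (𝓡 n) 𝓘(ℝ, ℝ) (v ∘ φ.symm) (φ y) :=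
      ((hw.contDiffAt (φ.open_target.mem_nhds (φ.map_source hy))).differentiableAt
        one_ne_zero).mdifferentiableAt
    have hd : HasMFDerivAt (𝓡 n) 𝓘(ℝ, ℝ) (v ∘ φ.symm) (φ y) 0 := by
      have := hwd.hasMFDerivAt
      rwa [mfderiv_eq_fderiv, h0] at this
    have := (hd.comp y hφd.hasMFDerivAt).congr_of_eventuallyEq hev
    have e := this.mfderiv
    simp only [mem_ofPred_eq]
    rw [e]
    exact ContinuousLinearMap.zero_comp _
  · exact Or.inr ⟨φ.map_source hy, h0, by simpa [φ.left_inv hy] using hyN⟩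

end Submersion

/-! ### Functions with vanishing mean -/

section Mean

variable {Ω ι : Type*}

/-- The good sets form a Dynkin class; countable disjoint unions pass by dominated convergence of
series. The whole space is a separate hypothesis because half-lines, the intended `C`, do not
include it. -/
theorem tendsto_setIntegral_zero_of_isPiSystem [mΩ : MeasurableSpace Ω] {ρ : Measure Ω}
    [IsFiniteMeasure ρ] {C : Set (Set Ω)} (hC : mΩ = .generateFrom C) (hpi : IsPiSystem C)
    {l : Filter ι} {F : ι → Ω → ℝ} {K : ℝ} (hF : ∀ t, Measurable (F t))
    (hK : ∀ t ω, ‖F t ω‖ ≤ K) (huniv : Tendsto (fun t => ∫ ω, F t ω ∂ρ) l (𝓝 0))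
    (hind : ∀ s ∈ C, Tendsto (fun t => ∫ ω in s, F t ω ∂ρ) l (𝓝 0)) :
    ∀ s, MeasurableSet s → Tendsto (fun t => ∫ ω in s, F t ω ∂ρ) l (𝓝 0) := by
  have hint : ∀ t, Integrable (F t) ρ := fun t =>
    .of_bound (hF t).aestronglyMeasurable K (.of_forall (hK t))
  refine MeasurableSpace.induction_on_inter hC hpi (by simpa using tendsto_const_nhds) hind ?_ ?_
  · intro s hs h0
    have := huniv.sub h0
    rw [sub_zero] at this
    exact this.congr fun t => by rw [← integral_add_compl hs (hint t), add_sub_cancel_left]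
  · intro f hd hf h0
    have hsum : Summable fun i => K * ρ.real (f i) := by
      refine Summable.mul_left K ?_
      have h1 : ∑' i, ρ (f i) ≠ ⊤ := by
        rw [← measure_iUnion hd hf]
        exact measure_ne_top _ _
      exact ENNReal.summable_toReal h1
    have := tendsto_tsum_of_dominated_convergence (𝓕 := l) (f := fun t i => ∫ ω in f i, F t ω ∂ρ)
      (g := fun _ => 0) hsum h0 (.of_forall fun t i =>
        norm_setIntegral_le_of_norm_le_const (measure_lt_top _ _) fun ω _ => hK t ω)
    simp only [tsum_zero] at this
    exact this.congr fun t => (integral_iUnion hf hd (hint t).integrableOn).symm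

/-- A bounded family whose integrals over bounded intervals tend to zero tends to zero for the
weak-* topology of `L∞(ℝ)`. -/
theorem tendsto_integral_mul_zero_of_intervals {l : Filter ι} {F : ι → ℝ → ℝ} {K : ℝ}
    (hF : ∀ t, Measurable (F t)) (hK : ∀ t r, ‖F t r‖ ≤ K)
    (hint : ∀ a b, a ≤ b → Tendsto (fun t => ∫ r in Ioc a b, F t r) l (𝓝 0)) {k : ℝ → ℝ}
    (hk : Integrable k) : Tendsto (fun t => ∫ r, k r * F t r) l (𝓝 0) := by
  have hFi : ∀ t {ρ : Measure ℝ} [IsFiniteMeasure ρ], Integrable (F t) ρ := fun t ρ _ =>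
    .of_bound (hF t).aestronglyMeasurable K (.of_forall (hK t))
  have hki : ∀ {k : ℝ → ℝ}, Integrable k → ∀ t, Integrable (fun r => k r * F t r) := fun hk t =>
    hk.mul_bdd (c := K) (hF t).aestronglyMeasurable (.of_forall (hK t))
  -- Lebesgue measure is infinite, so the Dynkin argument is run on each unit interval and the
  -- pieces are summed afterwards.
  have hpiece : ∀ (n : ℤ) (s : Set ℝ), MeasurableSet s →
      Tendsto (fun t => ∫ r in s ∩ Ioc (n : ℝ) (n + 1), F t r) l (𝓝 0) := by
    intro n s hs
    have := tendsto_setIntegral_zero_of_isPiSystem (ρ := volume.restrict (Ioc (n : ℝ) (n + 1)))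
      (borel_eq_generateFrom_Iic ℝ ▸ BorelSpace.measurable_eq) isPiSystem_Iic hF hK
      (hint _ _ (by simp)) (l := l) ?_ s hs
    · simpa only [Measure.restrict_restrict hs] using this
    · rintro _ ⟨a, rfl⟩
      simp only [Measure.restrict_restrict measurableSet_Iic]
      have e : Iic a ∩ Ioc (n : ℝ) (n + 1) = Ioc (n : ℝ) (min a (n + 1)) := by
        ext x
        simp only [mem_inter_iff, mem_Iic, mem_Ioc, le_min_iff]
        tauto
      rw [e]
      rcases le_total (n : ℝ) (min a (n + 1)) with h | h
      · exact hint _ _ h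
      · simpa [Ioc_eq_empty_of_le h] using tendsto_const_nhds
  have hset : ∀ s : Set ℝ, MeasurableSet s → volume s < ⊤ →
      Tendsto (fun t => ∫ r in s, F t r) l (𝓝 0) := by
    intro s hs hvs
    have : IsFiniteMeasure (volume.restrict s) := ⟨by simpa using hvs⟩
    have hU : s = ⋃ n : ℤ, s ∩ Ioc (n : ℝ) (n + 1) := by
      rw [← inter_iUnion, iUnion_Ioc_intCast, inter_univ]
    have hd : Pairwise (Function.onFun Disjoint fun n : ℤ => s ∩ Ioc (n : ℝ) (n + 1)) :=
      fun i j hij =>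
        (pairwise_disjoint_Ioc_intCast ℝ hij).mono inter_subset_right inter_subset_right
    have hm : ∀ n : ℤ, MeasurableSet (s ∩ Ioc (n : ℝ) (n + 1)) := fun n =>
      hs.inter measurableSet_Ioc
    have hsum : Summable fun n : ℤ => K * volume.real (s ∩ Ioc (n : ℝ) (n + 1)) := by
      refine Summable.mul_left K ?_
      have h1 : ∑' n : ℤ, volume (s ∩ Ioc (n : ℝ) (n + 1)) ≠ ⊤ := by
        rw [← measure_iUnion hd hm, ← hU]
        exact hvs.ne
      exact ENNReal.summable_toReal h1
    have := tendsto_tsum_of_dominated_convergence (𝓕 := l)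
      (f := fun t (n : ℤ) => ∫ r in s ∩ Ioc (n : ℝ) (n + 1), F t r)
      (g := fun _ => 0) hsum (fun n => hpiece n s hs) (.of_forall fun t i =>
        norm_setIntegral_le_of_norm_le_const ((measure_mono inter_subset_left).trans_lt hvs)
          fun ω _ => hK t ω)
    simp only [tsum_zero] at this
    refine this.congr fun t => ?_
    conv_rhs => rw [hU]
    refine (integral_iUnion hm hd ?_).symm
    rw [← hU]
    exact hFi t
  refine Integrable.induction (P := fun k => Tendsto (fun t => ∫ r, k r * F t r) l (𝓝 0))
    ?_ ?_ ?_ ?_ hk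
  · intro c s hs hvs
    have := (hset s hs hvs).const_mul c
    rw [mul_zero] at this
    refine this.congr fun t => ?_
    rw [← integral_const_mul, ← integral_indicator hs]
    congr 1 with r
    by_cases hr : r ∈ s <;> simp [hr]
  · intro f g _ hf hg h1 h2
    have := h1.add h2
    rw [add_zero] at this
    refine this.congr fun t => ?_
    rw [← integral_add (hki hf t) (hki hg t)]
    simp [add_mul]
  -- The functionals are `K`-Lipschitz on `L¹` uniformly in `t`, so the good densities form a closed
  -- set.
  · have hlip : ∀ t, LipschitzWith K.toNNReal
        fun f : ℝ →₁[volume] ℝ => ∫ r, (f : ℝ → ℝ) r * F t r := by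
      intro t
      refine LipschitzWith.of_dist_le_mul fun f g => ?_
      rw [dist_eq_norm, dist_eq_norm, ← integral_sub (hki (L1.integrable_coeFn f) t)
        (hki (L1.integrable_coeFn g) t), L1.norm_eq_integral_norm, ← integral_const_mul]
      refine norm_integral_le_of_norm_le ((L1.integrable_coeFn _).norm.const_mul _) ?_
      filter_upwards [Lp.coeFn_sub f g] with r hr
      rw [← sub_mul, norm_mul, hr, Pi.sub_apply, mul_comm]
      exact mul_le_mul_of_nonneg_right ((hK t r).trans (Real.le_coe_toNNReal K)) (norm_nonneg _)
    exact (LipschitzWith.uniformEquicontinuous _ _ hlip).equicontinuous.isClosed_setOfPred_tendsto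
      continuous_const
  · intro f g hfg _ hf
    refine hf.congr fun t => integral_congr_ae ?_
    filter_upwards [hfg] with r hr
    rw [hr]

variable {D : ℝ → ℝ} {K : ℝ}

theorem intervalIntegrable_of_bounded (hD : Measurable D) (hK : ∀ r, ‖D r‖ ≤ K) (a b : ℝ) :
    IntervalIntegrable D volume a b :=
  (intervalIntegrable_const (c := K)).mono_fun' hD.aestronglyMeasurable (.of_forall hK)

/-- A bounded function with vanishing mean along integer times has vanishing mean. -/
theorem tendsto_mean_zero_of_nat (hD : Measurable D) (hK : ∀ r, ‖D r‖ ≤ K)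
    (H : Tendsto (fun N : ℕ => (N : ℝ)⁻¹ * ∫ w in (0 : ℝ)..N, D w) atTop (𝓝 0))
    {b : ℝ} (hb : 0 < b) :
    Tendsto (fun t : ℝ => t⁻¹ * ∫ w in (0 : ℝ)..t * b, D w) atTop (𝓝 0) := by
  have hI := intervalIntegrable_of_bounded hD hK
  have hK0 : 0 ≤ K := (norm_nonneg _).trans (hK 0)
  -- The endpoint `t * b` is rounded down to an integer; the discarded piece has length at most `1`
  -- and contributes at most `K / t`.
  have h1 : Tendsto (fun t : ℝ => (⌊b * t⌋₊ : ℝ) / t *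
      ((⌊b * t⌋₊ : ℝ)⁻¹ * ∫ w in (0 : ℝ)..⌊b * t⌋₊, D w)) atTop (𝓝 (b * 0)) :=
    (tendsto_nat_floor_mul_div_atTop hb.le).mul
      (H.comp (tendsto_nat_floor_atTop.comp (tendsto_id.const_mul_atTop hb)))
  have h2 : Tendsto (fun t : ℝ => t⁻¹ * ∫ w in (⌊b * t⌋₊ : ℝ)..t * b, D w) atTop (𝓝 0) := by
    refine squeeze_zero_norm' ?_ (by simpa using tendsto_inv_atTop_zero.mul_const K)
    filter_upwards [eventually_gt_atTop 0] with t ht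
    rw [norm_mul, Real.norm_of_nonneg (inv_nonneg.2 ht.le)]
    refine mul_le_mul_of_nonneg_left ?_ (inv_nonneg.2 ht.le)
    refine (intervalIntegral.norm_integral_le_of_norm_le_const fun w _ => hK w).trans ?_
    refine mul_le_of_le_one_right hK0 ?_
    have h3 := Nat.floor_le (mul_pos hb ht).le
    have h4 := Nat.lt_floor_add_one (b * t)
    rw [abs_le]
    constructor <;> linarith
  have := h1.add h2
  rw [mul_zero, add_zero] at this
  refine this.congr' ?_
  filter_upwards [eventually_gt_atTop 0] with t ht
  rw [← intervalIntegral.integral_add_adjacent_intervals (hI 0 ⌊b * t⌋₊)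
    (hI ⌊b * t⌋₊ (t * b)), mul_add]
  congr 1
  rcases Nat.eq_zero_or_pos ⌊b * t⌋₊ with h0 | h0
  · simp [h0]
  · have : (⌊b * t⌋₊ : ℝ) ≠ 0 := by positivity
    field_simp

/-- Real-valued speeds may be negative, so the mean is needed in both time directions; the case `b <
0` follows by reflection. -/
theorem tendsto_mean_zero_of_nat_of_neg (hD : Measurable D) (hK : ∀ r, ‖D r‖ ≤ K)
    (H : Tendsto (fun N : ℕ => (N : ℝ)⁻¹ * ∫ w in (0 : ℝ)..N, D w) atTop (𝓝 0))
    (H' : Tendsto (fun N : ℕ => (N : ℝ)⁻¹ * ∫ w in (0 : ℝ)..N, D (-w)) atTop (𝓝 0)) (b : ℝ) :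
    Tendsto (fun t : ℝ => t⁻¹ * ∫ w in (0 : ℝ)..t * b, D w) atTop (𝓝 0) := by
  rcases lt_trichotomy b 0 with hb | rfl | hb
  · have := (tendsto_mean_zero_of_nat (hD.comp measurable_neg) (fun r => hK (-r)) H'
      (neg_pos.2 hb)).neg
    rw [neg_zero] at this
    refine this.congr fun t => ?_
    simp only [Function.comp_def]
    rw [intervalIntegral.integral_comp_neg, intervalIntegral.integral_symm]
    simp
  · simp
  · exact tendsto_mean_zero_of_nat hD hK H hb

/-- A bounded function with vanishing mean, sped up indefinitely, tends weakly to zero with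
respect to any finite measure which is absolutely continuous. -/
theorem tendsto_integral_comp_mul_zero (hD : Measurable D) (hK : ∀ r, ‖D r‖ ≤ K)
    (H : ∀ b, Tendsto (fun t : ℝ => t⁻¹ * ∫ w in (0 : ℝ)..t * b, D w) atTop (𝓝 0))
    {κ : Measure ℝ} [IsFiniteMeasure κ] (hκ : κ ≪ volume) (s : ℝ) :
    Tendsto (fun t : ℝ => ∫ r, D (s + t * r) ∂κ) atTop (𝓝 0) := by
  have hI := intervalIntegrable_of_bounded hD hK
  have hshift : ∀ b, Tendsto (fun t : ℝ => t⁻¹ * ∫ w in (0 : ℝ)..s + t * b, D w) atTop (𝓝 0) := by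
    intro b
    have h2 : Tendsto (fun t : ℝ => t⁻¹ * ∫ w in t * b..s + t * b, D w) atTop (𝓝 0) := by
      refine squeeze_zero_norm' ?_ (by simpa using tendsto_inv_atTop_zero.mul_const (K * |s|))
      filter_upwards [eventually_gt_atTop 0] with t ht
      rw [norm_mul, Real.norm_of_nonneg (inv_nonneg.2 ht.le)]
      refine mul_le_mul_of_nonneg_left ?_ (inv_nonneg.2 ht.le)
      simpa using intervalIntegral.norm_integral_le_of_norm_le_const
        (a := t * b) (b := s + t * b) fun w _ => hK w
    have := (H b).add h2
    rw [add_zero] at this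
    refine this.congr fun t => ?_
    rw [← mul_add, intervalIntegral.integral_add_adjacent_intervals (hI _ _) (hI _ _)]
  -- The test function is the density of `κ`. Over `(a, b]` the substitution `w = s + t * r` turns
  -- the integral into a difference of two means.
  have key := tendsto_integral_mul_zero_of_intervals (l := atTop)
    (F := fun t r => D (s + t * r)) (K := K) (fun t => by fun_prop) (fun t r => hK _) ?_
    (k := fun r => (κ.rnDeriv volume r).toReal) Measure.integrable_toReal_rnDeriv
  · refine key.congr fun t => ?_
    exact integral_rnDeriv_smul hκ
  · intro a b hab
    have := (hshift b).sub (hshift a)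
    rw [sub_zero] at this
    refine this.congr' ?_
    filter_upwards [eventually_gt_atTop 0] with t ht
    rw [← intervalIntegral.integral_of_le hab, intervalIntegral.integral_comp_add_mul _ ht.ne',
      ← mul_sub, intervalIntegral.integral_interval_sub_left (hI _ _) (hI _ _), smul_eq_mul]

end Mean

/-! ### The mean ergodic theorem for sets -/

section MeanErgodic

variable {A : Type*} [MeasurableSpace A] {ν : Measure A} [IsProbabilityMeasure ν]

/-- Von Neumann's theorem: the averages of `1_{A₁} ∘ T^k` converge in `L²` to a fixed vector, which
ergodicity makes constant. Testing against the whole space identifies the constant. -/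
theorem tendsto_average_measureReal_inter_preimage {T : A → A} (hT : Ergodic T ν) {A₁ A₂ : Set A}
    (h₁ : MeasurableSet A₁) (h₂ : MeasurableSet A₂) :
    Tendsto (fun N : ℕ => (N : ℝ)⁻¹ * ∑ k ∈ Finset.range N, ν.real (A₂ ∩ T^[k] ⁻¹' A₁)) atTop
      (𝓝 (ν.real A₂ * ν.real A₁)) := by
  have hmp := hT.toMeasurePreserving
  let U : Lp ℝ 2 ν →L[ℝ] Lp ℝ 2 ν :=
    (Lp.compMeasurePreservingₗᵢ ℝ T hmp).toContinuousLinearMap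
  set f : Lp ℝ 2 ν := indicatorConstLp 2 h₁ (measure_ne_top ν A₁) (1 : ℝ) with hf
  have hiter : ∀ k : ℕ, U^[k] f = indicatorConstLp 2 ((hT.measurable.iterate k) h₁)
      (measure_ne_top ν _) (1 : ℝ) := by
    intro k
    induction k with
    | zero => rfl
    | succ k ih =>
      rw [Function.iterate_succ_apply', ih]
      exact Lp.indicatorConstLp_compMeasurePreserving _ _ _ hmp
  have hlim := U.tendsto_birkhoffAverage_orthogonalProjection
    (LinearIsometry.norm_toContinuousLinearMap_le _) f
  set p := (U.eqLocus (1 : Lp ℝ 2 ν →L[ℝ] Lp ℝ 2 ν)).orthogonalProjectionOnto f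
  have hpU : U (p : Lp ℝ 2 ν) = p := p.2
  obtain ⟨c, hc⟩ : ∃ c : ℝ, (p : Lp ℝ 2 ν) =ᵐ[ν] Function.const A c := by
    refine hT.ae_eq_const_of_ae_eq_comp_ae (Lp.aestronglyMeasurable _) ?_
    have := Lp.coeFn_compMeasurePreserving (p : Lp ℝ 2 ν) hmp
    refine this.symm.trans ?_
    exact (congrArg (fun u : Lp ℝ 2 ν => (u : A → ℝ)) hpU).eventuallyEq
  have key : ∀ {B : Set A}, MeasurableSet B →
      Tendsto (fun N : ℕ => (N : ℝ)⁻¹ * ∑ k ∈ Finset.range N, ν.real (B ∩ T^[k] ⁻¹' A₁)) atTop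
      (𝓝 (ν.real B * c)) := by
    intro B hB
    have h3 := ((innerSL ℝ (indicatorConstLp 2 hB (measure_ne_top ν B) (1 : ℝ))).continuous.tendsto
      _).comp hlim
    have e : innerSL ℝ (indicatorConstLp 2 hB (measure_ne_top ν B) (1 : ℝ)) (p : Lp ℝ 2 ν)
        = ν.real B * c := by
      rw [innerSL_apply_apply, L2.inner_indicatorConstLp_one, setIntegral_congr_ae hB
        (hc.mono fun x hx _ => hx)]
      simp
    rw [e] at h3
    refine h3.congr fun N => ?_
    simp only [Function.comp_apply, birkhoffAverage, birkhoffSum, id, map_smul, map_sum,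
      smul_eq_mul]
    congr 1
    refine Finset.sum_congr rfl fun k _ => ?_
    rw [hiter, innerSL_apply_apply, L2.inner_indicatorConstLp_indicatorConstLp]
    simp
  have hc1 : c = ν.real A₁ := by
    have h4 := key MeasurableSet.univ
    simp only [univ_inter, probReal_univ, one_mul] at h4
    refine tendsto_nhds_unique h4 (tendsto_const_nhds.congr' ?_)
    filter_upwards [eventually_gt_atTop 0] with N hN
    have : (N : ℝ) ≠ 0 := by positivity
    simp only [measureReal_def, (hmp.iterate _).measure_preimage h₁.nullMeasurableSet]
    simp
    field_simp
  rw [← hc1]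
  exact key h₂

end MeanErgodic

/-! ### Fractional parts -/

section Fract

theorem measurable_fractI : Measurable fractI :=
  measurable_fract.subtype_mk

theorem fractI_ne_one (r : ℝ) : fractI r ≠ 1 := fun h =>
  (Int.fract_lt_one r).ne (congrArg Subtype.val h)

theorem fractI_add_int (r : ℝ) (k : ℤ) : fractI (r + k) = fractI r :=
  Subtype.ext (Int.fract_add_intCast r k)

theorem fractI_coe {s : unitInterval} (hs : s ≠ 1) : fractI s = s :=
  Subtype.ext (Int.fract_eq_self.2 ⟨s.2.1, lt_of_le_of_ne s.2.2 fun h => hs (Subtype.ext h)⟩)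

theorem ae_ne_one : ∀ᵐ s : unitInterval, s ≠ 1 := by
  rw [ae_iff]
  simp only [not_not]
  exact measure_singleton (1 : unitInterval)

theorem integral_unitInterval_eq (F : unitInterval → ℝ) :
    ∫ s : unitInterval, F s = ∫ w in (0 : ℝ)..1, F (fractI w) := by
  rw [intervalIntegral.integral_of_le zero_le_one, ← integral_Icc_eq_integral_Ioc,
    ← integral_subtype measurableSet_Icc]
  refine integral_congr_ae ?_
  filter_upwards [ae_ne_one] with s hs
  exact congrArg F (fractI_coe hs).symm

theorem intervalIntegral_comp_fractI (F : unitInterval → ℝ) (a : ℝ) :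
    ∫ w in a..a + 1, F (fractI w) = ∫ s : unitInterval, F s := by
  have hper : Function.Periodic (fun w => F (fractI w)) 1 := fun w => by
    simpa using congrArg F (fractI_add_int w 1)
  rw [integral_unitInterval_eq, hper.intervalIntegral_add_eq a 0, zero_add]

/-- Rotation invariance, from the fact that a `1`-periodic function has the same integral over `[0,
1]` and `[c, c + 1]`. -/
theorem measurePreserving_fractI_add (c : ℝ) :
    MeasurePreserving fun s : unitInterval => fractI (s + c) := by
  have hm : Measurable fun s : unitInterval => fractI (s + c) :=
    measurable_fractI.comp (measurable_subtype_coe.add_const c)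
  refine ⟨hm, Measure.ext fun B hB => ?_⟩
  rw [Measure.map_apply hm hB, ← measureReal_eq_measureReal_iff]
  have e : ∀ {S : Set unitInterval}, MeasurableSet S →
      volume.real S = ∫ s : unitInterval, S.indicator (fun _ => (1 : ℝ)) s := fun hS => by
    simp [integral_indicator hS]
  rw [e hB, e (hm hB), integral_unitInterval_eq,
    ← intervalIntegral_comp_fractI (B.indicator fun _ => (1 : ℝ)) c]
  have := intervalIntegral.integral_comp_add_right (a := 0) (b := 1)
    (fun w => B.indicator (fun _ => (1 : ℝ)) (fractI w)) c
  rw [zero_add, add_comm 1 c] at this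
  rw [← this]
  refine intervalIntegral.integral_congr fun w _ => ?_
  have : fractI ((fractI w : ℝ) + c) = fractI (w + c) := by
    rw [← fractI_add_int _ ⌊w⌋]
    congr 1
    simp only [fractI, Int.fract]
    ring
  rw [← this]
  rfl

end Fract

/-! ### The fundamental domain of the suspension -/

section FundamentalDomain

variable {A M : Type*} {T : A → A}

/-- The representative in `A × [0, 1)` of a point of the suspension. -/
noncomputable def Suspension.rep (T : A → A) : Suspension T → A × unitInterval := by
  classical exact
    Quot.lift (fun p => if p.2 = 1 then (T p.1, 0) else p) (by
      rintro ⟨x, s⟩ ⟨y, r⟩ ⟨h1, h2⟩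
      simp only [Prod.mk.injEq] at h1 h2
      obtain ⟨rfl, rfl⟩ := h2
      subst h1
      simp)

theorem Suspension.rep_mk {p : A × unitInterval} (hp : p.2 ≠ 1) :
    Suspension.rep T (Suspension.mk T p) = p := by
  simp [Suspension.rep, Suspension.mk, hp]

theorem Suspension.mk_rep (z : Suspension T) : Suspension.mk T (Suspension.rep T z) = z := by
  induction z using Quot.ind with
  | mk p =>
    by_cases hp : p.2 = 1
    · simp only [Suspension.rep, Suspension.mk, hp, if_true]
      exact (Quot.sound ⟨hp, rfl⟩).symm
    · simp only [Suspension.rep, Suspension.mk, hp, if_false]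
      rfl

/-- The parametrization of `Ω` by `(M × [0, 1]) × A`. -/
def param (T : A → A) (q : (M × unitInterval) × A) : Suspension T × M :=
  (Suspension.mk T (q.2, q.1.2), q.1.1)

/-- The measurable section of `param`. -/
noncomputable def paramSection (T : A → A) (p : Suspension T × M) : (M × unitInterval) × A :=
  ((p.2, (Suspension.rep T p.1).2), (Suspension.rep T p.1).1)

theorem param_paramSection (p : Suspension T × M) : param T (paramSection T p) = p :=
  Prod.ext (Suspension.mk_rep p.1) rfl

variable [MeasurableSpace A] [MeasurableSpace M]

theorem Suspension.measurable_mk : Measurable (Suspension.mk T) := fun _ h => h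

theorem Suspension.measurable_rep (hT : Measurable T) : Measurable (Suspension.rep T) := by
  have : Measurable fun p : A × unitInterval => if p.2 = 1 then (T p.1, 0) else p :=
    Measurable.ite (measurable_snd (measurableSet_singleton 1)) (by fun_prop) measurable_id
  intro B hB
  change MeasurableSet (Suspension.mk T ⁻¹' (Suspension.rep T ⁻¹' B))
  convert! this hB using 1

theorem measurePreserving_mk (T : A → A) (ν : Measure A) :
    MeasurePreserving (Suspension.mk T) (ν.prod volume) (suspensionMeasure T ν) :=
  ⟨Suspension.measurable_mk, rfl⟩

instance (T : A → A) (ν : Measure A) [IsProbabilityMeasure ν] :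
    IsProbabilityMeasure (suspensionMeasure T ν) :=
  Measure.isProbabilityMeasure_map Suspension.measurable_mk.aemeasurable

theorem measurable_paramSection (hT : Measurable T) :
    Measurable (paramSection T : Suspension T × M → _) := by
  have := Suspension.measurable_rep hT
  unfold paramSection
  fun_prop

theorem measurePreserving_param (T : A → A) (ν : Measure A) [IsProbabilityMeasure ν]
    (μM : Measure M) [IsProbabilityMeasure μM] :
    MeasurePreserving (param T) ((μM.prod volume).prod ν) ((suspensionMeasure T ν).prod μM) := by
  have h1 : MeasurePreserving (MeasurableEquiv.prodAssoc : (M × unitInterval) × A ≃ᵐ _)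
      ((μM.prod volume).prod ν) (μM.prod (volume.prod ν)) :=
    ⟨MeasurableEquiv.measurable _, Measure.prodAssoc_prod⟩
  have h2 := (MeasurePreserving.id μM).prod ((measurePreserving_mk T ν).comp
    (Measure.measurePreserving_swap (μ := (volume : Measure unitInterval)) (ν := ν)))
  exact Measure.measurePreserving_swap.comp (h2.comp h1)

/-- A fibered map of the suspension, translating by `u y` above `y`, preserves the measure. -/
theorem measurePreserving_of_fibered {ν : Measure A} [IsProbabilityMeasure ν]
    {μM : Measure M} [IsProbabilityMeasure μM] (hT : Measurable T) {τ : ℤ → A → A}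
    (hτ : ∀ k, MeasurePreserving (τ k) ν ν) {u : M → ℝ} (hu : Measurable u)
    {G : Suspension T × M → Suspension T × M}
    (hG : ∀ x (s : unitInterval) y, G (Suspension.mk T (x, s), y) =
      (Suspension.mk T (τ ⌊(s : ℝ) + u y⌋ x, fractI (s + u y)), y)) :
    MeasurePreserving G ((suspensionMeasure T ν).prod μM)
      ((suspensionMeasure T ν).prod μM) := by
  -- In these coordinates `G` is a double skew product: a rotation of `[0, 1]` depending on `y`,
  -- then a power `τ k` depending on `(y, s)`.
  let Ψ : (M × unitInterval) × A → (M × unitInterval) × A := fun q =>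
    ((q.1.1, fractI (q.1.2 + u q.1.1)), τ ⌊(q.1.2 : ℝ) + u q.1.1⌋ q.2)
  have hw : Measurable fun q : M × unitInterval => (q.2 : ℝ) + u q.1 := by fun_prop
  have hbase : MeasurePreserving (fun q : M × unitInterval => (q.1, fractI (q.2 + u q.1)))
      (μM.prod volume) (μM.prod volume) :=
    (MeasurePreserving.id μM).skew_product (g := fun y (s : unitInterval) => fractI ((s : ℝ) + u y))
      (measurable_fractI.comp hw) (.of_forall fun y => (measurePreserving_fractI_add (u y)).map_eq)
  have hτm : Measurable fun p : ℤ × A => τ p.1 p.2 :=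
    measurable_from_prod_countable_right fun k => (hτ k).measurable
  have hΨ : MeasurePreserving Ψ ((μM.prod volume).prod ν) ((μM.prod volume).prod ν) :=
    hbase.skew_product (g := fun (q : M × unitInterval) x => τ ⌊(q.2 : ℝ) + u q.1⌋ x)
      (hτm.comp ((Int.measurable_floor.comp (hw.comp measurable_fst)).prodMk measurable_snd))
      (.of_forall fun q => (hτ _).map_eq)
  have hsemi : ∀ q, G (param T q) = param T (Ψ q) := fun q => hG _ _ _
  have hπ := measurePreserving_param T ν μM
  -- The domain is a product with a quotient, so measurability goes through the measurable section
  -- of `param`.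
  have hGm : Measurable G := by
    have : G = param T ∘ Ψ ∘ paramSection T := by
      funext p
      simp only [Function.comp_apply, ← hsemi, param_paramSection]
    rw [this]
    exact hπ.measurable.comp (hΨ.measurable.comp (measurable_paramSection hT))
  refine ⟨hGm, ?_⟩
  conv_lhs => rw [← hπ.map_eq]
  rw [Measure.map_map hGm hπ.measurable, show G ∘ param T = param T ∘ Ψ from funext hsemi]
  exact (hπ.comp hΨ).map_eq

/-- The sets `{[(x, s)] : x ∈ A₁, s ∈ S₁} × M₁`, with `s ∈ [0, 1)`. -/
def box (T : A → A) (A₁ : Set A) (S₁ : Set unitInterval) (M₁ : Set M) : Set (Suspension T × M) :=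
  (Suspension.rep T ⁻¹' (A₁ ×ˢ S₁)) ×ˢ M₁

/-- The measurable boxes. -/
def boxes (T : A → A) (M : Type*) [MeasurableSpace M] : Set (Set (Suspension T × M)) :=
  {R | ∃ A₁ S₁ M₁, MeasurableSet A₁ ∧ MeasurableSet S₁ ∧ MeasurableSet M₁ ∧ R = box T A₁ S₁ M₁}

theorem isPiSystem_boxes (T : A → A) : IsPiSystem (boxes T M) := by
  rintro _ ⟨A₁, S₁, M₁, hA, hS, hM, rfl⟩ _ ⟨A₂, S₂, M₂, hA', hS', hM', rfl⟩ -
  refine ⟨A₁ ∩ A₂, S₁ ∩ S₂, M₁ ∩ M₂, hA.inter hA', hS.inter hS', hM.inter hM', ?_⟩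
  rw [box, box, box, prod_inter_prod, ← preimage_inter, prod_inter_prod]

theorem univ_mem_boxes (T : A → A) : univ ∈ boxes T M :=
  ⟨univ, univ, univ, .univ, .univ, .univ, by simp [box]⟩

/-- The identity factors as `param T ∘ paramSection T`. The section is measurable for the
`σ`-algebra generated by boxes, since its three coordinates pull measurable sets back to boxes, and
`param T` is measurable. -/
theorem generateFrom_boxes (hT : Measurable T) :
    (inferInstance : MeasurableSpace (Suspension T × M)) = .generateFrom (boxes T M) := by
  refine le_antisymm ?_ (MeasurableSpace.generateFrom_le ?_)
  · have hA : Measurable[.generateFrom (boxes T M)]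
        fun p : Suspension T × M => (Suspension.rep T p.1).1 := fun A₁ hA₁ =>
      .basic _ ⟨A₁, univ, univ, hA₁, .univ, .univ, by ext; simp [box]⟩
    have hS : Measurable[.generateFrom (boxes T M)]
        fun p : Suspension T × M => (Suspension.rep T p.1).2 := fun S₁ hS₁ =>
      .basic _ ⟨univ, S₁, univ, .univ, hS₁, .univ, by ext; simp [box]⟩
    have hM : Measurable[.generateFrom (boxes T M)]
        fun p : Suspension T × M => p.2 := fun M₁ hM₁ =>
      .basic _ ⟨univ, univ, M₁, .univ, .univ, hM₁, by ext; simp [box]⟩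
    have hsec : Measurable[.generateFrom (boxes T M)] (paramSection T : Suspension T × M → _) :=
      Measurable.prodMk (Measurable.prodMk hM hS) hA
    have hpar : Measurable (param T : (M × unitInterval) × A → Suspension T × M) := by
      have := Suspension.measurable_mk (T := T)
      unfold param
      fun_prop
    intro B hB
    have := hsec (hpar hB)
    rwa [← preimage_comp, show param T ∘ paramSection T = id from funext param_paramSection] at this
  · rintro _ ⟨A₁, S₁, M₁, hA, hS, hM, rfl⟩
    exact (Suspension.measurable_rep hT (hA.prod hS)).prod hM

end FundamentalDomain

/-! ### Correlations of boxes -/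

section Correlation

variable {A M : Type*} [MeasurableSpace A]

/-- The correlation along an orbit of the suspension: at time `w` it is `1_{S₁} (fract w)` times
the correlation `ν (A₂ ∩ (τ k)⁻¹ A₁)`, `k = ⌊w⌋`. -/
noncomputable def orbitCorrelation (ν : Measure A) (τ : ℤ → A → A) (A₁ A₂ : Set A)
    (S₁ : Set unitInterval) (w : ℝ) : ℝ :=
  S₁.indicator (fun _ => ν.real (A₂ ∩ τ ⌊w⌋ ⁻¹' A₁)) (fractI w)

variable {ν : Measure A} {τ : ℤ → A → A} {A₁ A₂ : Set A}
  {S₁ S₂ : Set unitInterval}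

theorem measurable_orbitCorrelation (hS₁ : MeasurableSet S₁) :
    Measurable (orbitCorrelation ν τ A₁ A₂ S₁) := by
  have h1 : Measurable fun w : ℝ => ν.real (A₂ ∩ τ ⌊w⌋ ⁻¹' A₁) :=
    (measurable_from_top (f := fun k : ℤ => ν.real (A₂ ∩ τ k ⁻¹' A₁))).comp Int.measurable_floor
  exact h1.indicator (measurable_fractI hS₁)

theorem orbitCorrelation_nonneg (w : ℝ) : 0 ≤ orbitCorrelation ν τ A₁ A₂ S₁ w :=
  indicator_nonneg (fun _ _ => measureReal_nonneg) _

theorem integral_orbitCorrelation (hS₁ : MeasurableSet S₁) (k : ℤ) :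
    ∫ w in (k : ℝ)..k + 1, orbitCorrelation ν τ A₁ A₂ S₁ w =
      ν.real (A₂ ∩ τ k ⁻¹' A₁) * volume.real S₁ := by
  have h1 : ∫ w in (k : ℝ)..k + 1, orbitCorrelation ν τ A₁ A₂ S₁ w =
      ∫ w in (k : ℝ)..k + 1, S₁.indicator (fun _ => ν.real (A₂ ∩ τ k ⁻¹' A₁)) (fractI w) := by
    -- Endpoints are dropped because the floor jumps at `k + 1`.
    refine intervalIntegral.integral_congr_Ioo_of_le (by simp) fun w hw => ?_
    have : ⌊w⌋ = k := Int.floor_eq_iff.2 ⟨hw.1.le, hw.2⟩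
    simp only [orbitCorrelation, this]
  rw [h1, intervalIntegral_comp_fractI, integral_indicator hS₁]
  simp [mul_comm]

variable [IsProbabilityMeasure ν]

theorem orbitCorrelation_le_one (w : ℝ) : orbitCorrelation ν τ A₁ A₂ S₁ w ≤ 1 :=
  indicator_le' (fun _ _ => measureReal_le_one) (fun _ _ => zero_le_one) _

theorem norm_orbitCorrelation_le (w : ℝ) : ‖orbitCorrelation ν τ A₁ A₂ S₁ w‖ ≤ 1 := by
  rw [Real.norm_of_nonneg (orbitCorrelation_nonneg w)]
  exact orbitCorrelation_le_one w

theorem integral_orbitCorrelation_nat (hS₁ : MeasurableSet S₁) (N : ℕ) :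
    ∫ w in (0 : ℝ)..N, orbitCorrelation ν τ A₁ A₂ S₁ w =
      (∑ k ∈ Finset.range N, ν.real (A₂ ∩ τ k ⁻¹' A₁)) * volume.real S₁ := by
  have hI := intervalIntegrable_of_bounded (measurable_orbitCorrelation (ν := ν) (τ := τ)
    (A₁ := A₁) (A₂ := A₂) hS₁) norm_orbitCorrelation_le
  have := intervalIntegral.sum_integral_adjacent_intervals (a := fun k : ℕ => (k : ℝ)) (n := N)
    fun k _ => hI k (k + 1 : ℕ)
  rw [Nat.cast_zero] at this
  rw [← this, Finset.sum_mul]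
  refine Finset.sum_congr rfl fun k _ => ?_
  simpa using integral_orbitCorrelation hS₁ (k : ℤ)

/-- For `w` in `(k, k + 1)` the floor of `-w` is `-(k + 1)`, whence the shifted index here and in
`HasMeanMixing`. -/
theorem integral_orbitCorrelation_neg_nat (hS₁ : MeasurableSet S₁) (N : ℕ) :
    ∫ w in (0 : ℝ)..N, orbitCorrelation ν τ A₁ A₂ S₁ (-w) =
      (∑ k ∈ Finset.range N, ν.real (A₂ ∩ τ (-(k + 1 : ℤ)) ⁻¹' A₁)) * volume.real S₁ := by
  have hI := intervalIntegrable_of_bounded ((measurable_orbitCorrelation (ν := ν) (τ := τ)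
    (A₁ := A₁) (A₂ := A₂) hS₁).comp measurable_neg) fun w => norm_orbitCorrelation_le (-w)
  have := intervalIntegral.sum_integral_adjacent_intervals (a := fun k : ℕ => (k : ℝ)) (n := N)
    fun k _ => hI k (k + 1 : ℕ)
  rw [Nat.cast_zero] at this
  simp only [Function.comp_def] at this
  rw [← this, Finset.sum_mul]
  refine Finset.sum_congr rfl fun k _ => ?_
  rw [intervalIntegral.integral_comp_neg, ← integral_orbitCorrelation hS₁]
  push_cast
  congr 1
  ring

/-- Both Cesàro means of the correlations of `τ` are those of a mixing system. -/
def HasMeanMixing (ν : Measure A) (τ : ℤ → A → A) : Prop :=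
  ∀ A₁ A₂ : Set A, MeasurableSet A₁ → MeasurableSet A₂ →
    Tendsto (fun N : ℕ => (N : ℝ)⁻¹ * ∑ k ∈ Finset.range N, ν.real (A₂ ∩ τ k ⁻¹' A₁)) atTop
      (𝓝 (ν.real A₂ * ν.real A₁)) ∧
    Tendsto (fun N : ℕ => (N : ℝ)⁻¹ * ∑ k ∈ Finset.range N,
      ν.real (A₂ ∩ τ (-(k + 1 : ℤ)) ⁻¹' A₁)) atTop (𝓝 (ν.real A₂ * ν.real A₁))

/-- Subtracting `c` leaves a bounded function with zero mean in both time directions, to which the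
speeding-up lemma applies. -/
theorem tendsto_integral_orbitCorrelation (hτ : HasMeanMixing ν τ) (hA₁ : MeasurableSet A₁)
    (hA₂ : MeasurableSet A₂) (hS₁ : MeasurableSet S₁) {κ : Measure ℝ} [IsFiniteMeasure κ]
    (hκ : κ ≪ volume) (s : ℝ) :
    Tendsto (fun t : ℝ => ∫ r, orbitCorrelation ν τ A₁ A₂ S₁ (s + t * r) ∂κ) atTop
      (𝓝 (κ.real univ * (ν.real A₂ * ν.real A₁ * volume.real S₁))) := by
  set c := ν.real A₂ * ν.real A₁ * volume.real S₁ with hc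
  have hm := measurable_orbitCorrelation (ν := ν) (τ := τ) (A₁ := A₁) (A₂ := A₂) hS₁
  have hI := intervalIntegrable_of_bounded hm norm_orbitCorrelation_le
  have hI' : ∀ a b, IntervalIntegrable (fun w => orbitCorrelation ν τ A₁ A₂ S₁ (-w)) volume a b :=
    intervalIntegrable_of_bounded (hm.comp measurable_neg) fun w => norm_orbitCorrelation_le (-w)
  have hD : Measurable fun w => orbitCorrelation ν τ A₁ A₂ S₁ w - c := hm.sub_const c
  have hK : ∀ w, ‖orbitCorrelation ν τ A₁ A₂ S₁ w - c‖ ≤ 1 + ‖c‖ := fun w =>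
    (norm_sub_le _ _).trans (add_le_add_left (norm_orbitCorrelation_le w) _)
  have aux : ∀ u : ℕ → ℝ, Tendsto (fun N : ℕ => (N : ℝ)⁻¹ * u N) atTop
      (𝓝 (ν.real A₂ * ν.real A₁)) →
      Tendsto (fun N : ℕ => (N : ℝ)⁻¹ * (u N * volume.real S₁ - N * c)) atTop (𝓝 0) := by
    intro u hu
    have := (hu.mul_const (volume.real S₁)).sub_const c
    rw [← hc, sub_self] at this
    refine this.congr' ?_
    filter_upwards [eventually_gt_atTop 0] with N hN
    have : (N : ℝ) ≠ 0 := by positivity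
    field_simp
  have key := tendsto_integral_comp_mul_zero hD hK
    (tendsto_mean_zero_of_nat_of_neg hD hK ?_ ?_) hκ s
  · have := key.add_const (κ.real univ * c)
    rw [zero_add] at this
    refine this.congr fun t => ?_
    rw [integral_sub _ (integrable_const c)]
    · simp
    · have hmt : Measurable fun r : ℝ => orbitCorrelation ν τ A₁ A₂ S₁ (s + t * r) :=
        hm.comp (by fun_prop)
      exact .of_bound hmt.aestronglyMeasurable 1 (.of_forall fun _ => norm_orbitCorrelation_le _)
  · refine (aux _ (hτ A₁ A₂ hA₁ hA₂).1).congr fun N => ?_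
    rw [intervalIntegral.integral_sub (hI _ _) intervalIntegrable_const,
      integral_orbitCorrelation_nat hS₁]
    simp
  · refine (aux _ (hτ A₁ A₂ hA₁ hA₂).2).congr fun N => ?_
    rw [intervalIntegral.integral_sub (hI' _ _) intervalIntegrable_const,
      integral_orbitCorrelation_neg_nat hS₁]
    simp

variable [MeasurableSpace M] {μM : Measure M} [IsProbabilityMeasure μM] {M₁ M₂ : Set M} {T : A → A}

theorem measureReal_box_inter_preimage_box (hT : Measurable T)
    (hτ : ∀ k, MeasurePreserving (τ k) ν ν) {u : M → ℝ} (hu : Measurable u)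
    {G : Suspension T × M → Suspension T × M}
    (hG : ∀ x (s : unitInterval) y, G (Suspension.mk T (x, s), y) =
      (Suspension.mk T (τ ⌊(s : ℝ) + u y⌋ x, fractI (s + u y)), y))
    (hA₁ : MeasurableSet A₁) (hA₂ : MeasurableSet A₂) (hS₁ : MeasurableSet S₁)
    (hS₂ : MeasurableSet S₂) (hM₁ : MeasurableSet M₁) (hM₂ : MeasurableSet M₂) :
    ((suspensionMeasure T ν).prod μM).real (box T A₂ S₂ M₂ ∩ G ⁻¹' box T A₁ S₁ M₁) =
      ∫ s in S₂, ∫ y in M₁ ∩ M₂, orbitCorrelation ν τ A₁ A₂ S₁ (s + u y) ∂μM := by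
  have hπ := measurePreserving_param T ν μM
  have hGm := (measurePreserving_of_fibered (μM := μM) hT hτ hu hG).measurable
  have hbox : ∀ {A₁ : Set A} {S₁ : Set unitInterval} {M₁ : Set M}, MeasurableSet A₁ →
      MeasurableSet S₁ → MeasurableSet M₁ → MeasurableSet (box T A₁ S₁ M₁) := fun hA hS hM =>
    (Suspension.measurable_rep hT (hA.prod hS)).prod hM
  have hB : MeasurableSet (param T ⁻¹' (box T A₂ S₂ M₂ ∩ G ⁻¹' box T A₁ S₁ M₁)) :=
    hπ.measurable ((hbox hA₂ hS₂ hM₂).inter (hGm (hbox hA₁ hS₁ hM₁)))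
  have hDm := measurable_orbitCorrelation (ν := ν) (τ := τ) (A₁ := A₁) (A₂ := A₂) hS₁
  -- Fubini with `A` innermost: the `x`-slice at fixed `(y, s)` has measure `orbitCorrelation`. The
  -- null slice `s = 1` is excluded because `Suspension.rep` moves its points.
  have hslice : ∀ᵐ q : M × unitInterval ∂μM.prod volume,
      (ν (Prod.mk q ⁻¹' (param T ⁻¹' (box T A₂ S₂ M₂ ∩ G ⁻¹' box T A₁ S₁ M₁)))).toReal =
        ((M₁ ∩ M₂) ×ˢ S₂).indicator
          (fun q => orbitCorrelation ν τ A₁ A₂ S₁ (q.2 + u q.1)) q := by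
    filter_upwards [Measure.quasiMeasurePreserving_snd.ae ae_ne_one] with q hq
    obtain ⟨y, s⟩ := q
    have hq' : s ≠ 1 := hq
    have hmem : Prod.mk (y, s) ⁻¹' (param T ⁻¹' (box T A₂ S₂ M₂ ∩ G ⁻¹' box T A₁ S₁ M₁)) =
        {x | (x ∈ A₂ ∧ s ∈ S₂) ∧ y ∈ M₂ ∧
          (τ ⌊(s : ℝ) + u y⌋ x ∈ A₁ ∧ fractI (s + u y) ∈ S₁) ∧ y ∈ M₁} := by
      ext x
      simp only [mem_preimage, param, box, mem_inter_iff, mem_prod, hG, mem_ofPred_eq, and_assoc,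
        Suspension.rep_mk (T := T) (p := (x, s)) hq',
        Suspension.rep_mk (T := T) (p := (τ ⌊(s : ℝ) + u y⌋ x, fractI (s + u y)))
          (fractI_ne_one _)]
    rw [hmem]
    by_cases h : (y ∈ M₁ ∧ y ∈ M₂) ∧ s ∈ S₂
    · rw [indicator_of_mem (by exact h), orbitCorrelation]
      by_cases h' : fractI (s + u y) ∈ S₁
      · rw [indicator_of_mem h']
        simp only [h, h', true_and, and_true, measureReal_def]
        rfl
      · simp [h']
    · rw [indicator_of_notMem (by exact h)]
      have : {x | (x ∈ A₂ ∧ s ∈ S₂) ∧ y ∈ M₂ ∧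
          (τ ⌊(s : ℝ) + u y⌋ x ∈ A₁ ∧ fractI (s + u y) ∈ S₁) ∧ y ∈ M₁} = ∅ := by
        ext x
        simp only [mem_ofPred_eq, mem_empty_iff_false, iff_false]
        tauto
      simp [this]
  rw [measureReal_def, ← hπ.measure_preimage ((hbox hA₂ hS₂ hM₂).inter
    (hGm (hbox hA₁ hS₁ hM₁))).nullMeasurableSet, Measure.prod_apply hB,
    ← integral_toReal (measurable_measure_prodMk_left hB).aemeasurable
      (.of_forall fun _ => measure_lt_top _ _), integral_congr_ae hslice,
    integral_indicator ((hM₁.inter hM₂).prod hS₂), ← Measure.prod_restrict, integral_prod_symm]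
  refine .of_bound ?_ 1 (.of_forall fun _ => norm_orbitCorrelation_le _)
  have : Measurable fun q : M × unitInterval => (q.2 : ℝ) + u q.1 := by fun_prop
  exact (hDm.comp this).aestronglyMeasurable

/-- For fixed `s`, take `κ` to be the law of `v` under `μM` restricted to `M'`; then integrate in
`s` by dominated convergence. -/
theorem tendsto_integral_orbitCorrelation_speed (hτ : HasMeanMixing ν τ) (hA₁ : MeasurableSet A₁)
    (hA₂ : MeasurableSet A₂) (hS₁ : MeasurableSet S₁) (M' : Set M)
    {v : M → ℝ} (hv : Measurable v) (hac : μM.map v ≪ volume) :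
    Tendsto (fun t : ℝ => ∫ s in S₂, ∫ y in M', orbitCorrelation ν τ A₁ A₂ S₁ (s + v y * t) ∂μM)
      atTop (𝓝 (volume.real S₂ * (μM.real M' * (ν.real A₂ * ν.real A₁ * volume.real S₁)))) := by
  have hDm := measurable_orbitCorrelation (ν := ν) (τ := τ) (A₁ := A₁) (A₂ := A₂) hS₁
  have key : ∀ s : ℝ, Tendsto
      (fun t : ℝ => ∫ y in M', orbitCorrelation ν τ A₁ A₂ S₁ (s + v y * t) ∂μM) atTop
      (𝓝 (μM.real M' * (ν.real A₂ * ν.real A₁ * volume.real S₁))) := by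
    intro s
    have := tendsto_integral_orbitCorrelation (κ := (μM.restrict M').map v) hτ hA₁ hA₂ hS₁
      ((Measure.restrict_le_self.absolutelyContinuous.map hv).trans hac) s
    have e : ((μM.restrict M').map v).real univ = μM.real M' := by
      rw [map_measureReal_apply hv .univ]
      simp
    rw [e] at this
    refine this.congr fun t => ?_
    have hmt : Measurable fun r : ℝ => orbitCorrelation ν τ A₁ A₂ S₁ (s + t * r) :=
      hDm.comp (by fun_prop)
    rw [integral_map hv.aemeasurable hmt.aestronglyMeasurable]
    simp only [mul_comm]
  have hconst : volume.real S₂ * (μM.real M' * (ν.real A₂ * ν.real A₁ * volume.real S₁)) =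
      ∫ s : unitInterval in S₂, μM.real M' * (ν.real A₂ * ν.real A₁ * volume.real S₁) := by
    simp
  rw [hconst]
  refine tendsto_integral_filter_of_dominated_convergence (fun _ => 1) (.of_forall fun t => ?_)
    (.of_forall fun t => .of_forall fun s => ?_) (integrable_const _) (.of_forall fun s => key s)
  · have : Measurable fun q : unitInterval × M =>
        orbitCorrelation ν τ A₁ A₂ S₁ (q.1 + v q.2 * t) := by fun_prop
    exact (this.stronglyMeasurable.integral_prod_right (ν := μM.restrict M')).aestronglyMeasurable
  · refine (norm_integral_le_of_norm_le_const (.of_forall fun _ =>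
      norm_orbitCorrelation_le _)).trans ?_
    simp [measureReal_le_one]

end Correlation

/-! ### Conditional expectation on the base -/

section CondExp

variable {Y M : Type*} [MeasurableSpace Y] [MeasurableSpace M] {ρ : Measure Y}
  [IsProbabilityMeasure ρ] {μM : Measure M} [IsProbabilityMeasure μM]

theorem setIntegral_condExp_snd_indicator_prod {P₁ P₂ : Set Y} {M₁ M₂ : Set M}
    (hP₁ : MeasurableSet P₁) (hP₂ : MeasurableSet P₂) (hM₁ : MeasurableSet M₁)
    (hM₂ : MeasurableSet M₂) :
    ∫ ω in P₂ ×ˢ M₂, ((ρ.prod μM)[(P₁ ×ˢ M₁).indicator fun _ => (1 : ℂ) |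
      MeasurableSpace.comap Prod.snd inferInstance]) ω ∂ρ.prod μM =
      ((ρ.real P₁ * ρ.real P₂ * μM.real (M₁ ∩ M₂) : ℝ) : ℂ) := by
  have hm : MeasurableSpace.comap (Prod.snd : Y × M → M) inferInstance ≤
      (inferInstance : MeasurableSpace (Y × M)) := measurable_snd.comap_le
  have hind : ∀ B : Set (Y × M), MeasurableSet B → ∀ c : ℂ, Integrable (B.indicator fun _ => c)
    (ρ.prod μM) := fun B hB c => (integrable_const c).indicator hB
  -- Conditioning on the second coordinate averages out the first, leaving `ρ(P₁) 1_{M₁}`.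
  have h : (univ ×ˢ M₁).indicator (fun _ => (ρ.real P₁ : ℂ)) =ᵐ[ρ.prod μM]
      (ρ.prod μM)[(P₁ ×ˢ M₁).indicator fun _ => (1 : ℂ) |
        MeasurableSpace.comap Prod.snd inferInstance] := by
    refine ae_eq_condExp_of_forall_setIntegral_eq hm (hind _ (hP₁.prod hM₁) 1)
      (fun _ _ _ => (hind _ (.prod .univ hM₁) _).integrableOn) ?_ ?_
    · rintro _ ⟨M', hM', rfl⟩ -
      rw [setIntegral_indicator (MeasurableSet.univ.prod hM₁),
        setIntegral_indicator (hP₁.prod hM₁), setIntegral_const, setIntegral_const,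
        show (Prod.snd ⁻¹' M' : Set (Y × M)) ∩ univ ×ˢ M₁ = univ ×ˢ (M' ∩ M₁) by ext; simp,
        show (Prod.snd ⁻¹' M' : Set (Y × M)) ∩ P₁ ×ˢ M₁ = P₁ ×ˢ (M' ∩ M₁) by
          ext; simp; tauto, measureReal_prod_prod, measureReal_prod_prod]
      simp [mul_comm]
    · refine StronglyMeasurable.aestronglyMeasurable ?_
      exact stronglyMeasurable_const.indicator ⟨M₁, hM₁, by ext; simp⟩
  rw [← setIntegral_congr_ae (hP₂.prod hM₂) (h.mono fun ω hω _ => hω),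
    setIntegral_indicator (MeasurableSet.univ.prod hM₁), setIntegral_const, prod_inter_prod,
    inter_univ, measureReal_prod_prod, inter_comm M₂]
  simp only [Complex.real_smul, Complex.ofReal_mul]
  ring

end CondExp

/-! ### Shear for fibered families of translations of the suspension -/

section Fibered

variable {A M ι : Type*} [MeasurableSpace A] [MeasurableSpace M] {ν : Measure A}
  [IsProbabilityMeasure ν] {μM : Measure M} [IsProbabilityMeasure μM] {T : A → A} {τ : ℤ → A → A}

/-- Common to semi-flow and flow: `τ k` stands for the `k`-th power of `T`, and `e` embeds the time
set in `ℝ`. -/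
theorem exhibitsKeplerianShear_of_fibered [AddMonoid ι] [Preorder ι] [(atTop : Filter ι).NeBot]
    (hT : Measurable T) (hτ : ∀ k, MeasurePreserving (τ k) ν ν) (hmix : HasMeanMixing ν τ)
    {v : M → ℝ} (hv : Measurable v) (hac : μM.map v ≪ volume) {e : ι → ℝ}
    (he : Tendsto e atTop atTop) {g : ι → Suspension T × M → Suspension T × M}
    (hzero : g 0 = id) (hadd : ∀ s t, g (s + t) = g s ∘ g t)
    (hg : ∀ t x (s : unitInterval) y, g t (Suspension.mk T (x, s), y) =
      (Suspension.mk T (τ ⌊(s : ℝ) + v y * e t⌋ x, fractI (s + v y * e t)), y)) :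
    ExhibitsKeplerianShear g ((suspensionMeasure T ν).prod μM) := by
  have hmp : ∀ t, MeasurePreserving (g t) ((suspensionMeasure T ν).prod μM)
      ((suspensionMeasure T ν).prod μM) := fun t =>
    measurePreserving_of_fibered hT hτ (hv.mul_const (e t)) (hg t)
  refine ⟨⟨inferInstance, hzero, hadd, hmp⟩, fun f h hf hh => ?_⟩
  have hm : MeasurableSpace.comap (Prod.snd : Suspension T × M → M) inferInstance ≤
      (inferInstance : MeasurableSpace (Suspension T × M)) := measurable_snd.comap_le
  have hI : invariantSigmaAlgebra g ≤ (inferInstance : MeasurableSpace (Suspension T × M)) :=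
    (iInf_le _ 0).trans (MeasurableSpace.invariants_le _)
  have hsnd : ∀ t p, (g t p).2 = p.2 := by
    rintro t ⟨z, y⟩
    rw [← Suspension.mk_rep z, ← Prod.mk.eta (p := Suspension.rep T z), hg]
  have hmI : MeasurableSpace.comap (Prod.snd : Suspension T × M → M) inferInstance ≤
      invariantSigmaAlgebra g := by
    refine le_iInf fun t => ?_
    rintro _ ⟨M', hM', rfl⟩
    refine MeasurableSpace.measurableSet_invariants.2 ⟨measurable_snd hM', ?_⟩
    ext p
    simp [hsnd]
  have key : ∀ {f h : Suspension T × M → ℂ}, MemLp f 2 ((suspensionMeasure T ν).prod μM) →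
      MemLp h 2 ((suspensionMeasure T ν).prod μM) →
      Tendsto (fun t => ∫ ω, conj (h ω) * f (g t ω) ∂(suspensionMeasure T ν).prod μM) atTop
        (𝓝 (∫ ω, conj (h ω) * (((suspensionMeasure T ν).prod μM)[f |
          MeasurableSpace.comap Prod.snd inferInstance]) ω ∂(suspensionMeasure T ν).prod μM)) := by
    intro f h hf hh
    refine tendsto_integral_conj_mul_comp_of_indicator (generateFrom_boxes hT)
      (isPiSystem_boxes T) (univ_mem_boxes T) hmp hm ?_ hf hh
    rintro _ _ - - ⟨A₂, S₂, M₂, hA₂, hS₂, hM₂, rfl⟩ ⟨A₁, S₁, M₁, hA₁, hS₁, hM₁, rfl⟩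
    have hrep : ∀ {A₁ : Set A} {S₁ : Set unitInterval}, MeasurableSet A₁ → MeasurableSet S₁ →
        (suspensionMeasure T ν).real (Suspension.rep T ⁻¹' (A₁ ×ˢ S₁)) =
          ν.real A₁ * volume.real S₁ := by
      intro A₁ S₁ hA hS
      rw [measureReal_def, ← (measurePreserving_mk T ν).measure_preimage
        (Suspension.measurable_rep hT (hA.prod hS)).nullMeasurableSet, ← measureReal_def,
        ← measureReal_prod_prod]
      refine measureReal_congr ?_
      filter_upwards [Measure.quasiMeasurePreserving_snd.ae ae_ne_one] with p hp
      exact propext (by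
        change Suspension.rep T (Suspension.mk T p) ∈ A₁ ×ˢ S₁ ↔ p ∈ A₁ ×ˢ S₁
        rw [Suspension.rep_mk hp])
    have hlim := (Complex.continuous_ofReal.tendsto _).comp
      ((tendsto_integral_orbitCorrelation_speed (S₂ := S₂) hmix hA₁ hA₂ hS₁ (M₁ ∩ M₂) hv hac).comp
        he)
    rw [box, box, setIntegral_condExp_snd_indicator_prod
      (Suspension.measurable_rep hT (hA₁.prod hS₁)) (Suspension.measurable_rep hT (hA₂.prod hS₂))
      hM₁ hM₂, hrep hA₁ hS₁, hrep hA₂ hS₂]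
    convert! hlim using 1
    · funext t
      exact congrArg Complex.ofReal (measureReal_box_inter_preimage_box hT hτ
        (hv.mul_const (e t)) (hg t) hA₁ hA₂ hS₁ hS₂ hM₁ hM₂)
    · congr 2
      ring
  have hcond := condExp_invariantSigmaAlgebra_ae_eq hmp hmI hI hf fun h hh => key hf hh
  rw [← integral_congr_ae (hcond.mono fun ω hω => congrArg (conj (h ω) * ·) hω)]
  exact key hf hh

end Fibered

/-! ### The suspension semi-flow and flow -/

section Flows

variable {A M : Type*}

theorem Suspension.exists_eq_mk {T : A → A} (z : Suspension T) :
    ∃ (x : A) (s : unitInterval), s ≠ 1 ∧ z = Suspension.mk T (x, s) := by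
  induction z using Quot.ind with
  | mk p =>
    obtain ⟨x, s⟩ := p
    by_cases hs : s = 1
    · exact ⟨T x, 0, zero_ne_one, Quot.sound ⟨hs, rfl⟩⟩
    · exact ⟨x, s, hs, rfl⟩

theorem suspensionSemiflow_zero (T : A → A) (z : Suspension T) : suspensionSemiflow T 0 z = z := by
  obtain ⟨x, s, hs, rfl⟩ := z.exists_eq_mk
  have h1 : (s : ℝ) < 1 := lt_of_le_of_ne s.2.2 fun h => hs (Subtype.ext h)
  change Suspension.mk T (T^[⌊(s : ℝ) + ((0 : ℝ≥0) : ℝ)⌋₊] x, fractI (s + ((0 : ℝ≥0) : ℝ))) = _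
  rw [NNReal.coe_zero, add_zero, fractI_coe hs, Nat.floor_eq_zero.2 h1, Function.iterate_zero_apply]

theorem suspensionSemiflow_add (T : A → A) (c d : ℝ≥0) (z : Suspension T) :
    suspensionSemiflow T (c + d) z = suspensionSemiflow T c (suspensionSemiflow T d z) := by
  obtain ⟨x, s, -, rfl⟩ := z.exists_eq_mk
  change Suspension.mk T (T^[⌊(s : ℝ) + ((c + d : ℝ≥0) : ℝ)⌋₊] x, fractI (s + ((c + d : ℝ≥0) : ℝ)))
    = Suspension.mk T (T^[⌊(fractI (s + d) : ℝ) + c⌋₊] (T^[⌊(s : ℝ) + d⌋₊] x),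
      fractI (fractI (s + d) + c))
  have h0 : 0 ≤ (s : ℝ) + d := add_nonneg s.2.1 d.2
  -- The integer part crossed during time `d` is split off; it adds to the floor and leaves the
  -- fractional part unchanged.
  have e1 : (s : ℝ) + ((c + d : ℝ≥0) : ℝ) = (fractI (s + d) : ℝ) + c + (⌊(s : ℝ) + d⌋₊ : ℕ) := by
    have : ((⌊(s : ℝ) + d⌋₊ : ℕ) : ℝ) = ⌊(s : ℝ) + d⌋ := natCast_floor_eq_intCast_floor h0
    rw [this, NNReal.coe_add]
    simp only [fractI, Int.fract]
    ring
  have e2 : fractI (s + ((c + d : ℝ≥0) : ℝ)) = fractI (fractI (s + d) + c) := by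
    rw [e1]
    exact fractI_add_int _ (⌊(s : ℝ) + d⌋₊ : ℤ)
  have h1 : 0 ≤ (fractI (s + d) : ℝ) + (c : ℝ) := add_nonneg (fractI (s + d)).2.1 c.2
  rw [e2, e1, Nat.floor_add_natCast h1, Function.iterate_add_apply]

variable [MeasurableSpace A]

theorem suspensionFlow_zero (T : A ≃ᵐ A) (z : Suspension T) : suspensionFlow T 0 z = z := by
  obtain ⟨x, s, hs, rfl⟩ := z.exists_eq_mk
  have h1 : (s : ℝ) < 1 := lt_of_le_of_ne s.2.2 fun h => hs (Subtype.ext h)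
  change Suspension.mk T (((T.toEquiv : Equiv.Perm A) ^ ⌊(s : ℝ) + 0⌋) x, fractI (s + 0)) = _
  rw [add_zero, fractI_coe hs, Int.floor_eq_zero_iff.2 ⟨s.2.1, h1⟩, zpow_zero]
  rfl

theorem suspensionFlow_add (T : A ≃ᵐ A) (c d : ℝ) (z : Suspension T) :
    suspensionFlow T (c + d) z = suspensionFlow T c (suspensionFlow T d z) := by
  obtain ⟨x, s, -, rfl⟩ := z.exists_eq_mk
  change Suspension.mk T
      (((T.toEquiv : Equiv.Perm A) ^ ⌊(s : ℝ) + (c + d)⌋) x, fractI (s + (c + d)))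
    = Suspension.mk T (((T.toEquiv : Equiv.Perm A) ^ ⌊(fractI (s + d) : ℝ) + c⌋)
      (((T.toEquiv : Equiv.Perm A) ^ ⌊(s : ℝ) + d⌋) x), fractI (fractI (s + d) + c))
  have e1 : (s : ℝ) + (c + d) = (fractI (s + d) : ℝ) + c + (⌊(s : ℝ) + d⌋ : ℤ) := by
    simp only [fractI, Int.fract]
    ring
  rw [e1, fractI_add_int, Int.floor_add_intCast, zpow_add, Equiv.Perm.mul_apply]

theorem coe_toEquiv_zpow_natCast (T : A ≃ᵐ A) (k : ℕ) :
    ⇑((T.toEquiv : Equiv.Perm A) ^ (k : ℤ)) = T^[k] := by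
  rw [zpow_natCast, ← Equiv.Perm.iterate_eq_pow]
  rfl

theorem measurePreserving_zpow {ν : Measure A} {T : A ≃ᵐ A} (hT : MeasurePreserving T ν ν) (k : ℤ) :
    MeasurePreserving ((T.toEquiv : Equiv.Perm A) ^ k) ν ν := by
  obtain ⟨j, rfl | rfl⟩ := k.eq_nat_or_neg
  · rw [coe_toEquiv_zpow_natCast]
    exact hT.iterate j
  · have : ⇑((T.toEquiv : Equiv.Perm A) ^ (-(j : ℤ))) = T.symm^[j] := by
      rw [zpow_neg, ← inv_zpow]
      exact coe_toEquiv_zpow_natCast T.symm j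
    rw [this]
    exact (hT.symm T).iterate j

variable {ν : Measure A} [IsProbabilityMeasure ν]

theorem tendsto_average_measureReal_inter_preimage_succ {T : A → A} (hT : Ergodic T ν)
    {A₁ A₂ : Set A} (h₁ : MeasurableSet A₁) (h₂ : MeasurableSet A₂) :
    Tendsto (fun N : ℕ => (N : ℝ)⁻¹ * ∑ k ∈ Finset.range N, ν.real (A₂ ∩ T^[k + 1] ⁻¹' A₁)) atTop
      (𝓝 (ν.real A₂ * ν.real A₁)) := by
  have := tendsto_average_measureReal_inter_preimage hT (hT.measurable h₁) h₂
  rw [measureReal_def (s := T ⁻¹' A₁), hT.toMeasurePreserving.measure_preimage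
    h₁.nullMeasurableSet, ← measureReal_def] at this
  simpa only [← preimage_comp, ← Function.iterate_succ', Nat.succ_eq_add_one] using this

/-- For non-invertible `T`, negative indices are filler: the semi-flow only meets nonnegative
floors. Using `natAbs` keeps the two-sided statement true. -/
theorem hasMeanMixing_iterate {T : A → A} (hT : Ergodic T ν) :
    HasMeanMixing ν fun k : ℤ => T^[k.natAbs] := by
  refine fun A₁ A₂ h₁ h₂ => ⟨?_, ?_⟩
  · simpa using tendsto_average_measureReal_inter_preimage hT h₁ h₂
  · have e : ∀ k : ℕ, (-(k + 1 : ℤ)).natAbs = k + 1 := fun k => by omega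
    simpa only [e] using tendsto_average_measureReal_inter_preimage_succ hT h₁ h₂

theorem hasMeanMixing_zpow {T : A ≃ᵐ A} (hT : Ergodic T ν) :
    HasMeanMixing ν fun k : ℤ => ⇑((T.toEquiv : Equiv.Perm A) ^ k) := by
  refine fun A₁ A₂ h₁ h₂ => ⟨?_, ?_⟩
  · simpa only [coe_toEquiv_zpow_natCast] using
      tendsto_average_measureReal_inter_preimage hT h₁ h₂
  -- Pulling back by `T^[k + 1]` exchanges the roles of `A₁` and `A₂`, so the backward mean is a
  -- forward one.
  · have e : ∀ k : ℕ, ν.real (A₂ ∩ ((T.toEquiv : Equiv.Perm A) ^ (-(k + 1 : ℤ))) ⁻¹' A₁) =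
        ν.real (A₁ ∩ T^[k + 1] ⁻¹' A₂) := by
      intro k
      have hm := (measurePreserving_zpow hT.toMeasurePreserving (-(k + 1 : ℤ))).measurable h₁
      rw [measureReal_def, ← (hT.toMeasurePreserving.iterate (k + 1)).measure_preimage
        (h₂.inter hm).nullMeasurableSet, ← measureReal_def, preimage_inter, inter_comm]
      congr 2
      ext x
      simp only [mem_preimage]
      rw [← coe_toEquiv_zpow_natCast, ← Equiv.Perm.mul_apply, ← zpow_add]
      simp
    simp only [e]
    rw [mul_comm]
    exact tendsto_average_measureReal_inter_preimage_succ hT h₂ h₁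

end Flows

end KeplerianShear

theorem mainTheorem4 {A M : Type*} [MeasurableSpace A] (ν : Measure A) [IsProbabilityMeasure ν]
    (n : ℕ) (hn : 1 ≤ n) [TopologicalSpace M] [T2Space M] [SecondCountableTopology M]
    [ChartedSpace (EuclideanSpace ℝ (Fin n)) M] [IsManifold (𝓡 n) 1 M]
    [MeasurableSpace M] [BorelSpace M]
    (μM : Measure M) [IsProbabilityMeasure μM]
    (hμM : KeplerianShear.LebesgueAbsolutelyContinuous n μM) :
    -- semi-flows: `T` ergodic, positive speed
    (∀ (T : A → A), Ergodic T ν →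
      ∀ v : M → ℝ≥0, (∀ y, 0 < v y) →
        ContMDiff (𝓡 n) 𝓘(ℝ, ℝ) 1 (fun y => (v y : ℝ)) →
        KeplerianShear.LebesgueNull n
          {y : M | mfderiv (𝓡 n) 𝓘(ℝ, ℝ) (fun y => (v y : ℝ)) y = 0} →
        KeplerianShear.ExhibitsKeplerianShear (KeplerianShear.fiberedSemiflow T v)
          ((KeplerianShear.suspensionMeasure T ν).prod μM)) ∧
    -- flows: `T` ergodic and invertible, real speed
    (∀ (T : A ≃ᵐ A), Ergodic T ν →
      ∀ v : M → ℝ, ContMDiff (𝓡 n) 𝓘(ℝ, ℝ) 1 v →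
        KeplerianShear.LebesgueNull n {y : M | mfderiv (𝓡 n) 𝓘(ℝ, ℝ) v y = 0} →
        KeplerianShear.ExhibitsKeplerianShear (KeplerianShear.fiberedFlow T v)
          ((KeplerianShear.suspensionMeasure T ν).prod μM)) := by
  refine ⟨fun T hT v _ hv hcrit => ?_, fun T hT v hv hcrit => ?_⟩
  · refine KeplerianShear.exhibitsKeplerianShear_of_fibered hT.measurable
      (fun k => hT.toMeasurePreserving.iterate k.natAbs) (KeplerianShear.hasMeanMixing_iterate hT)
      hv.continuous.measurable (KeplerianShear.map_absolutelyContinuous_volume hμM hv hcrit)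
      (e := fun t : ℝ≥0 => (t : ℝ)) (NNReal.tendsto_coe_atTop.2 tendsto_id) ?_ (fun s t => ?_)
      fun t x s y => ?_
    · funext p
      refine Prod.ext ?_ rfl
      simp only [KeplerianShear.fiberedSemiflow, mul_zero, id,
        KeplerianShear.suspensionSemiflow_zero]
    · funext p
      refine Prod.ext ?_ rfl
      simp only [KeplerianShear.fiberedSemiflow, mul_add, Function.comp_apply,
        KeplerianShear.suspensionSemiflow_add]
    · have h0 : 0 ≤ (s : ℝ) + v y * t := add_nonneg s.2.1 (v y * t).2
      have hfl : ⌊(s : ℝ) + v y * t⌋.natAbs = ⌊(s : ℝ) + v y * t⌋₊ := by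
        rw [← Int.floor_toNat]
        have := Int.floor_nonneg.2 h0
        omega
      rw [hfl]
      rfl
  · refine KeplerianShear.exhibitsKeplerianShear_of_fibered T.measurable
      (KeplerianShear.measurePreserving_zpow hT.toMeasurePreserving)
      (KeplerianShear.hasMeanMixing_zpow hT)
      hv.continuous.measurable (KeplerianShear.map_absolutelyContinuous_volume hμM hv hcrit)
      (e := id) tendsto_id ?_ (fun s t => ?_) fun t x s y => rfl
    · funext p
      refine Prod.ext ?_ rfl
      simp only [KeplerianShear.fiberedFlow, mul_zero, id, KeplerianShear.suspensionFlow_zero]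
    · funext p
      refine Prod.ext ?_ rfl
      simp only [KeplerianShear.fiberedFlow, mul_add, Function.comp_apply,
        KeplerianShear.suspensionFlow_add]
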